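/- Let $W$ be a smooth scheme over a field $k$ (of any characteristic), and let $\mathbb{Q}_{\geq 0}$ denote the non-negative rationals. A $\mathbb{Q}$-Rees algebra over $W$ is $\mathcal{J}=\bigoplus_{a\in\mathbb{Q}_{\ge 0}}J_aT^a$, where the $J_a\subset\mathcal{O}_W$ are coherent sheaves of ideals such that $J_0=\mathcal{O}_W$, $J_aJ_b\subset J_{a+b}$ for all $a,b$, $J_b\subset J_a$ whenever $a\le b$, and $\mathcal{J}$ is finitely generated in the following sense: $W$ has a covering by affine open sets $U$ for each of which there are $f_1,\dots,f_r\in\mathcal{O}_W(U)$ and $a_1,\dots,a_r\in\mathbb{Q}_{\ge 0}$ with $f_i\in J_{a_i}(U)$ such that, for every $a\in\mathbb{Q}_{\ge 0}$, the ideal $J_a(U)$ is generated by the products $f_{i_1}\cdots f_{i_\ell}$ with $a_{i_1}+\cdots+a_{i_\ell}\ge a$. Let $\mathcal{J}$ be a $\mathbb{Q}$-Rees algebra over $W$. For $U\subset W$ open, $f\in\mathcal{O}_W(U)$ and $a\in\mathbb{Q}_{\ge 0}$, the element $fT^a$ is integral over $\mathcal{J}$ if $f^m+c_1f^{m-1}+\cdots+c_m=0$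 for some $m$ and some $c_i\in J_{ia}(U)$, $i=1,\dots,m$. The integral closure $\bar{\mathcal{J}}$ is the sheaf of $\mathcal{O}_W$-subalgebras of $\bigoplus_{a\in\mathbb{Q}_{\ge 0}}\mathcal{O}_WT^a$ generated by all $fT^a$ integral over $\mathcal{J}$. For $\xi\in W$ and $f\in\mathcal{O}_{W,\xi}$ put $\nu_{\mathcal{J}}(f)=\sup\{a\mid f\in (J_a)_\xi\}\in[0,\infty]$ and $\bar\nu_{\mathcal{J}}(f)=\lim_{n\to\infty}\nu_{\mathcal{J}}(f^n)/n$. For $U\subset W$ open, $f\in\mathcal{O}_W(U)$ and $a\in\mathbb{Q}_{\ge 0}$, the element $fT^a$ is radical over $\mathcal{J}$ if $\bar\nu_{\mathcal{J}}(f_\xi)\ge a$ for the germ $f_\xi$ of $f$ at every point $\xi\in U$. The radical saturation $\mathfrak{R}(\mathcal{J})$ is the sheaf of $\mathcal{O}_W$-subalgebras of $\bigoplus_{a\in\mathbb{Q}_{\ge 0}}\mathcal{O}_WT^a$ generated by all $fT^a$ radical over $\mathcal{J}$. Then $\mathfrak{R}(\mathcal{J})$ is a $\mathbb{Q}$-Rees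 algebra over $W$ (in particular it is finitely generated), the integral closure $\bar{\mathcal{J}}$ is a $\mathbb{Q}$-Rees algebra over $W$, and $\bar{\mathcal{J}}=\mathfrak{R}(\mathcal{J})$. -/

import Mathlib

open AlgebraicGeometry CategoryTheory TopologicalSpace Filter Topology
open scoped ENNReal NNReal

universe u

noncomputable section

namespace QRees

/-- A collection of ideals `(J a)`, `a ∈ ℚ≥0`, of a ring `R` such that `⨁ J a T^a` is a
`ℚ`-Rees algebra over `R`. -/
structure IsQReesRing {R : Type u} [CommRing R] (J : ℚ≥0 → Ideal R) : Prop where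
  zero : J 0 = ⊤
  mul : ∀ a b, J a * J b ≤ J (a + b)
  anti : ∀ a b, a ≤ b → J b ≤ J a
  /-- There are `f₁, …, f_r` with `fᵢ ∈ J (dᵢ)` such that each `J a` is the ideal generated by the
  products `f_{i₁} ⋯ f_{i_l}` with `d_{i₁} + ⋯ + d_{i_l} ≥ a`. -/
  fg : ∃ (r : ℕ) (f : Fin r → R) (d : Fin r → ℚ≥0), (∀ i, f i ∈ J (d i)) ∧
    ∀ a, J a = Ideal.span {g | ∃ l : List (Fin r), a ≤ (l.map d).sum ∧ g = (l.map f).prod}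

/-- A `ℚ`-Rees algebra over a scheme `W`: quasi-coherent ideal sheaves `J a`, `a ∈ ℚ≥0`
(on a locally Noetherian scheme these are the coherent ones), that form a `ℚ`-Rees algebra over
`Γ(W, U)` for all `U` in some affine open covering of `W`. -/
structure QReesAlgebra (W : Scheme.{u}) where
  J : ℚ≥0 → W.IdealSheafData
  zero : J 0 = ⊤
  mul : ∀ a b, J a * J b ≤ J (a + b)
  anti : ∀ a b, a ≤ b → J b ≤ J a
  fg : ∃ C : Set W.affineOpens, (∀ x : W, ∃ U ∈ C, x ∈ U.1) ∧
    ∀ U ∈ C, IsQReesRing fun a => (J a).ideal U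

variable {W : Scheme.{u}}

/-- Restriction of a function on `U` to a smaller open set `V`. -/
def res {U V : W.Opens} (h : V ≤ U) (f : Γ(W, U)) : Γ(W, V) :=
  W.presheaf.map (homOfLE h).op f

/-- The sections over an arbitrary open set `U` of an ideal sheaf (which is recorded through its
sections over affine open sets). -/
def sections (I : W.IdealSheafData) (U : W.Opens) : Set Γ(W, U) :=
  {f | ∀ (V : W.affineOpens) (h : V.1 ≤ U), res h f ∈ I.ideal V}

/-- The stalk at `ξ` of an ideal sheaf, as a subset of the local ring of `W` at `ξ`. -/
def stalk (I : W.IdealSheafData) (ξ : W) : Set (W.presheaf.stalk ξ) :=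
  {f | ∃ (V : W.affineOpens) (h : ξ ∈ V.1), ∃ g ∈ I.ideal V, W.presheaf.germ V.1 ξ h g = f}

/-- A homogeneous `ℚ≥0`-graded family of subsheaves of `𝒪_W`: in degree `a`, and over each open set
`U`, the set of all `f ∈ Γ(W, U)` such that `f T^a` belongs to the family. -/
abbrev GradedFamily (W : Scheme.{u}) := ℚ≥0 → ∀ U : W.Opens, Set Γ(W, U)

/-- The graded family of sheaves `⨁ J a T^a` of a `ℚ`-Rees algebra. -/
def QReesAlgebra.family (𝒥 : QReesAlgebra W) : GradedFamily W := fun a U => sections (𝒥.J a) U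

/-- The graded `𝒪_W`-subalgebra of `⨁_{a ∈ ℚ≥0} 𝒪_W T^a` generated by the homogeneous elements
`f T^a` with `f ∈ S a V`: its sections of degree `a` over `U` are the `f` such that, locally on `U`,
`f T^a` lies in the `Γ(W, V)`-subalgebra of `⨁_b Γ(W, V) T^b` generated by the given elements. -/
def generated (S : GradedFamily W) : GradedFamily W := fun a U =>
  {f | ∀ x ∈ U, ∃ (V : W.Opens) (h : V ≤ U), x ∈ V ∧
    AddMonoidAlgebra.single a (res h f) ∈
      Algebra.adjoin Γ(W, V)
        {p : AddMonoidAlgebra Γ(W, V) ℚ≥0 | ∃ b, ∃ g ∈ S b V, p = AddMonoidAlgebra.single b g}}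

/-- `f T^a`, with `f ∈ Γ(W, U)`, is integral over `𝒥`: there is an equation
`f^m + c₁ f^(m-1) + ⋯ + c_m = 0` with `c_i ∈ J_{ia}(U)`. -/
def IsIntegralElem (𝒥 : QReesAlgebra W) (a : ℚ≥0) (U : W.Opens) (f : Γ(W, U)) : Prop :=
  ∃ (m : ℕ) (c : ℕ → Γ(W, U)),
    (∀ i ∈ Finset.Icc 1 m, c i ∈ sections (𝒥.J (i * a)) U) ∧
    f ^ m + ∑ i ∈ Finset.Icc 1 m, c i * f ^ (m - i) = 0

/-- The integral closure of `𝒥`. -/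
def integralClosure (𝒥 : QReesAlgebra W) : GradedFamily W :=
  generated fun a U => {f | IsIntegralElem 𝒥 a U f}

/-- `ν(f) = sup {a | f T^a ∈ 𝒥_ξ}`, for `f` in the local ring at `ξ`. -/
def nu (𝒥 : QReesAlgebra W) (ξ : W) (f : W.presheaf.stalk ξ) : ℝ≥0∞ :=
  ⨆ a ∈ {a : ℚ≥0 | f ∈ stalk (𝒥.J a) ξ}, ((a : ℝ≥0) : ℝ≥0∞)

/-- `L = lim ν(f^n) / n`. -/
def HasNuBar (𝒥 : QReesAlgebra W) (ξ : W) (f : W.presheaf.stalk ξ) (L : ℝ≥0∞) : Prop :=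
  Tendsto (fun n : ℕ => nu 𝒥 ξ (f ^ n) / (n : ℝ≥0∞)) atTop (𝓝 L)

/-- `f T^a`, with `f ∈ Γ(W, U)`, is radical over `𝒥`: at every point of `U` the limit
`lim ν(f^n) / n` is at least `a`. -/
def IsRadicalElem (𝒥 : QReesAlgebra W) (a : ℚ≥0) (U : W.Opens) (f : Γ(W, U)) : Prop :=
  ∀ (ξ : W) (h : ξ ∈ U), ∃ L : ℝ≥0∞,
    HasNuBar 𝒥 ξ (W.presheaf.germ U ξ h f) L ∧ ((a : ℝ≥0) : ℝ≥0∞) ≤ L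

/-- The radical saturation of `𝒥`. -/
def radicalSaturation (𝒥 : QReesAlgebra W) : GradedFamily W :=
  generated fun a U => {f | IsRadicalElem 𝒥 a U f}

end QRees

end

/-! ### Reducedness of smooth algebras and finiteness of Frobenius. -/

namespace ReesClosure

/-! The heart is affine. Let `A` be smooth over `k` and let `J` be generated by elements `f i` of
degrees in `(1/N)ℕ`. The extended Rees algebra `R = ⨁ J_{n/N} T^n`, `n ∈ ℤ`, is of finite type over
`k`, and inverting its nonzerodivisor `u = T⁻¹` gives the smooth algebra `A[T, T⁻¹]`. The integral
closure `C` of `R` in `A[T, T⁻¹]` is a finite `R`-module (`finite_integralClosure_of_smooth`): over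
the algebraic closure of `k` all rings stay reduced, so finiteness of normalization applies, and it
descends.

Thus `C` is Noetherian and integrally closed in `C[1/u]`. Its localizations at the finitely many
associated primes of `C ⧸ (u)` have principal maximal ideals, and the resulting orders decide
divisibility by powers of `u`. With `E` the product of the orders of `u`, asymptotic divisibility
has bounded denominators (`exists_pow_dvd_pow`). So the degree `a` part of the integral closure
depends only on `⌈aM⌉`, where `M = EN` (`exists_intCl_le_intCl_ceil`).

This has two consequences. Finitely many homogeneous module generators for the lattice `(1/M)ℕ`,
together with the `f i`, generate the closure in all rational degrees (`isQReesRing_intCl`). And for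
`a > 0` some `b < a` has the same closure as `a` (`exists_lt_intCl_le`).

An integral equation of degree `m` puts `f^(m+n)` in `J_{na}`, so integral elements are radical.
Conversely, if `f T^a` is radical, then for each `b < a` some `f^n`, `n > 0`, lies locally in
`J_{nb}`. Hence `f T^b` is integral, and a suitable `b` yields degree `a`. -/

theorem isReduced_of_smooth (k A : Type u) [Field k] [CommRing A] [Algebra k A]
    [Algebra.Smooth k A] : IsReduced A := by
  have key (m : Ideal A) [m.IsPrime] : ∃ f ∉ m, IsReduced (Localization.Away f) := by
    obtain ⟨f, hfm, n, hA, _, hE⟩ :=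
      Algebra.IsSmoothAt.exists_isStandardEtale_mvPolynomial (R := k) (p := m)
    refine ⟨f, hfm, ?_⟩
    let P := MvPolynomial (Fin n) k
    let B := Localization.Away f
    let K := FractionRing P
    -- An étale `B` is flat over the polynomial ring `P`, so it embeds in `K ⊗ B`, which is étale
    -- over the field `K` and therefore reduced.
    have : Algebra.Etale P B := inferInstance
    have : Module.Flat P B := inferInstance
    have : Algebra.Etale K (TensorProduct P K B) := inferInstance
    have : IsReduced (TensorProduct P K B) := Algebra.FormallyUnramified.isReduced_of_field K _
    exact isReduced_of_injective (Algebra.TensorProduct.includeRight : B →ₐ[P] TensorProduct P K B)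
      (Algebra.TensorProduct.includeRight_injective (IsFractionRing.injective P K))
  refine ⟨fun x hx => ?_⟩
  by_contra h0
  have hne : Ideal.span {x} ≠ ⊥ := by simpa using h0
  -- A nonzero nilpotent `x` has its annihilator inside some maximal `m`; but `x` dies in a reduced
  -- `A_f` with `f ∉ m`, so a power of `f` annihilates it.
  have h1 : Submodule.annihilator (Ideal.span {x}) ≠ ⊤ := by
    rw [Ne, Submodule.annihilator_eq_top_iff]; exact hne
  obtain ⟨m, hm, hle⟩ := Ideal.exists_le_maximal _ h1
  obtain ⟨f, hfm, hred⟩ := key m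
  have h2 : algebraMap A (Localization.Away f) x = 0 := (hx.map _).eq_zero
  rw [IsLocalization.map_eq_zero_iff (Submonoid.powers f)] at h2
  obtain ⟨⟨_, n, rfl⟩, hn⟩ := h2
  refine hfm (hm.isPrime.mem_of_pow_mem n (hle ?_))
  rw [Ideal.submodule_span_eq.symm, Submodule.mem_annihilator_span_singleton]
  simpa using hn

theorem finite_of_injective_restrictScalars {P Q N C : Type*} [CommRing P] [IsNoetherianRing P]
    [CommRing Q] [Algebra P Q] [Module.Finite P Q] [AddCommGroup N] [Module Q N]
    [Module.Finite Q N] [AddCommGroup C] [Module P C] (φ : C →+ N) (hφ : Function.Injective φ)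
    (h : ∀ (p : P) c, φ (p • c) = algebraMap P Q p • φ c) : Module.Finite P C := by
  let : Module P N := Module.compHom N (algebraMap P Q)
  have : IsScalarTower P Q N := ⟨fun x y z => by
    rw [Algebra.smul_def, mul_smul]; rfl⟩
  have : Module.Finite P N := Module.Finite.trans Q N
  let ψ : C →ₗ[P] N := { φ with map_smul' := h }
  exact Module.Finite.of_injective ψ hφ

/-- Serves for `σ` an iterate of Frobenius: raising to the power `p^e` is only semilinear, but
finiteness of `σ` keeps the target finite over the twisted scalars. -/
theorem finite_of_semilinear_injective {P N C : Type*} [CommRing P] [IsNoetherianRing P]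
    [AddCommGroup N] [Module P N] [Module.Finite P N] [AddCommGroup C] [Module P C]
    (σ : P →+* P) (hσ : σ.Finite) (φ : C →+ N) (hφ : Function.Injective φ)
    (h : ∀ p c, φ (p • c) = σ p • φ c) : Module.Finite P C :=
  @finite_of_injective_restrictScalars P P N C _ _ _ σ.toAlgebra hσ _ _ _ _ _ φ hφ h

/-- Integrality comes from `X^(p^e) - x`. Finite type uses perfectness: Frobenius is bijective on
the constants. -/
theorem iterateFrobenius_mvPolynomial_finite (k : Type*) [Field k] (p : ℕ) [ExpChar k p]
    [PerfectRing k p] (s e : ℕ) :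
    (iterateFrobenius (MvPolynomial (Fin s) k) p e).Finite := by
  apply RingHom.IsIntegral.to_finite
  · intro x
    by_cases hp : p ^ e = 0
    · exact absurd hp (pow_ne_zero _ (expChar_pos k p).ne')
    · refine ⟨Polynomial.X ^ (p ^ e) - Polynomial.C x, Polynomial.monic_X_pow_sub_C _ hp, ?_⟩
      simp [iterateFrobenius_def]
  · apply RingHom.FiniteType.of_comp_finiteType (f := (MvPolynomial.C : k →+* MvPolynomial (Fin s) k))
    have : (iterateFrobenius (MvPolynomial (Fin s) k) p e).comp MvPolynomial.C =
        (MvPolynomial.C).comp (iterateFrobenius k p e) := by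
      ext x; simp [iterateFrobenius_def]
    rw [this]
    refine RingHom.FiniteType.comp ?_ (RingHom.FiniteType.of_surjective _ ?_)
    · have : Algebra.FiniteType k (MvPolynomial (Fin s) k) := inferInstance
      exact (RingHom.finiteType_algebraMap (A := k)).mpr this
    · exact (bijective_iterateFrobenius k p e).2

end ReesClosure

/-! ### Finiteness of normalization over a perfect field. -/

namespace ReesClosure

/-- The integral closure of a polynomial ring over a perfect field in a finite extension of its
fraction field is finite. -/
theorem finite_integralClosure_mvPolynomial (k : Type*) [Field k] [PerfectField k] (s : ℕ)
    (L : Type*) [Field L] [Algebra (MvPolynomial (Fin s) k) L]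
    [Algebra (FractionRing (MvPolynomial (Fin s) k)) L]
    [IsScalarTower (MvPolynomial (Fin s) k) (FractionRing (MvPolynomial (Fin s) k)) L]
    [FiniteDimensional (FractionRing (MvPolynomial (Fin s) k)) L] :
    Module.Finite (MvPolynomial (Fin s) k) (integralClosure (MvPolynomial (Fin s) k) L) := by
  set P := MvPolynomial (Fin s) k
  set F := FractionRing P
  obtain ⟨p, hp⟩ := ExpChar.exists k
  have : ExpChar P p := expChar_of_injective_algebraMap (MvPolynomial.C_injective (Fin s) k) p
  have : ExpChar F p := expChar_of_injective_algebraMap (IsFractionRing.injective P F) p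
  have : ExpChar L p := expChar_of_injective_algebraMap (algebraMap F L).injective p
  let M := separableClosure F L
  have : ExpChar M p := expChar_of_injective_algebraMap (algebraMap F M).injective p
  have : IsPurelyInseparable M L := separableClosure.isPurelyInseparable F L
  have : FiniteDimensional M L := inferInstance
  obtain ⟨e, he⟩ := (IsPurelyInseparable.hasExponent_iff' M L p).mp inferInstance
  have : Module.Finite P (integralClosure P M) := IsIntegralClosure.finite P F M _
  have : IsScalarTower P M L := IsScalarTower.of_algebraMap_eq fun _ => rfl
  have hPM : Function.Injective (algebraMap M L) := (algebraMap M L).injective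
  choose g hg using he
  have hgi (x : integralClosure P L) : IsIntegral P (g x) := by
    have : IsIntegral P (algebraMap M L (g x)) := by
      rw [hg]; exact x.2.pow _
    exact (isIntegral_algebraMap_iff hPM).mp this
  -- The map `x ↦ x^(p^e)` carries the purely inseparable extension `L` of `M` into `M`, where the
  -- separable case gives finiteness.
  let φ : integralClosure P L →+ integralClosure P M :=
    { toFun := fun x => ⟨g x, hgi x⟩
      map_zero' := by
        apply Subtype.ext; apply hPM
        simp only [hg, map_zero, ZeroMemClass.coe_zero]
        exact zero_pow (pow_ne_zero _ (expChar_pos k p).ne')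
      map_add' := fun x y => by
        apply Subtype.ext; apply hPM
        simp only [hg, map_add, AddMemClass.coe_add]
        exact add_pow_expChar_pow _ _ _ _ }
  have hφ (x : integralClosure P L) : algebraMap M L (φ x : M) = (x : L) ^ p ^ e := hg _
  have hPR : PerfectRing k p := inferInstance
  refine finite_of_semilinear_injective (iterateFrobenius P p e)
    (iterateFrobenius_mvPolynomial_finite k p s e) φ (fun x y hxy => ?_) (fun c x => ?_)
  · have h1 : (x : L) ^ p ^ e = (y : L) ^ p ^ e := by rw [← hφ, ← hφ, hxy]
    exact Subtype.ext (iterateFrobenius_inj L p e h1)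
  · apply Subtype.ext; apply hPM
    have h1 : ((iterateFrobenius P p e c • φ x : integralClosure P M) : M) =
        algebraMap P M (c ^ p ^ e) * (φ x : M) := Algebra.smul_def _ _
    have h2 : ((c • x : integralClosure P L) : L) = algebraMap P L c * x := Algebra.smul_def _ _
    rw [hφ, h1, h2, map_mul, hφ, mul_pow, ← IsScalarTower.algebraMap_apply, map_pow]

/-- Over a perfect field, the normalization of a finitely generated domain is finite. -/
theorem finite_integralClosure_fractionRing (k D L : Type*) [Field k] [PerfectField k]
    [CommRing D] [IsDomain D] [Algebra k D] [Algebra.FiniteType k D] [Field L] [Algebra D L]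
    [IsFractionRing D L] : Module.Finite D (integralClosure D L) := by
  obtain ⟨s, g, hg, hfin⟩ := exists_finite_inj_algHom_of_fg k D
  let P := MvPolynomial (Fin s) k
  algebraize [g.toRingHom]
  have : Module.Finite P D := hfin
  let : Algebra P L := ((algebraMap D L).comp g.toRingHom).toAlgebra
  have : IsScalarTower P D L := IsScalarTower.of_algebraMap_eq' rfl
  have hPL : Function.Injective (algebraMap P L) :=
    (IsFractionRing.injective D L).comp hg
  have : FaithfulSMul P L := (faithfulSMul_iff_algebraMap_injective P L).mpr hPL
  let F := FractionRing P
  let : Algebra F L := FractionRing.liftAlgebra P L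
  have : IsScalarTower P F L := FractionRing.isScalarTower_liftAlgebra P L
  have : FaithfulSMul P D := (faithfulSMul_iff_algebraMap_injective P D).mpr hg
  have : Algebra.IsIntegral P D := inferInstance
  have : Algebra.IsAlgebraic P D := inferInstance
  have : IsLocalization (Algebra.algebraMapSubmonoid D (nonZeroDivisors P)) L :=
    Algebra.IsAlgebraic.instIsLocalizationAlgebraMapSubmonoidNonZeroDivisors P D L
  have : FiniteDimensional F L := Module.Finite.of_isLocalization P D (nonZeroDivisors P)
  have : Module.Finite P (integralClosure P L) := finite_integralClosure_mvPolynomial k s L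
  let ψ : integralClosure D L →ₗ[P] integralClosure P L :=
    { toFun := fun x => ⟨x, isIntegral_trans (R := P) (A := D) _ x.2⟩
      map_add' := fun _ _ => rfl
      map_smul' := fun p x => Subtype.ext (by simp) }
  have : Module.Finite P (integralClosure D L) :=
    Module.Finite.of_injective ψ fun x y h =>
      Subtype.ext (congrArg (fun z : integralClosure P L => (z : L)) h)
  exact Module.Finite.of_restrictScalars_finite P D _

end ReesClosure

/-! ### Finiteness of the integral closure in a localization `R[1/u]`. -/

namespace ReesClosure

/-- The closure embeds in the product of the normalizations of the `R ⧸ p`, `p` a minimal prime. The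
nonzerodivisor `u` avoids every `p`, so `S` maps to each fraction field; injectivity holds because
the minimal primes of a reduced ring meet in zero. -/
theorem finite_integralClosure_of_perfectField (k R S : Type*) [Field k] [PerfectField k]
    [CommRing R] [IsReduced R] [Algebra k R] [Algebra.FiniteType k R] [CommRing S] [Algebra R S]
    (u : R) (hu : u ∈ nonZeroDivisors R) [IsLocalization.Away u S] :
    Module.Finite R (integralClosure R S) := by
  have : IsNoetherianRing R := Algebra.FiniteType.isNoetherianRing k R
  have : Finite (minimalPrimes R) := minimalPrimes.finite_of_isNoetherianRing R
  have hp (p : minimalPrimes R) : p.1.IsPrime := p.2.1.1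
  let D (p : minimalPrimes R) := R ⧸ p.1
  let K (p : minimalPrimes R) := FractionRing (D p)
  have (p : minimalPrimes R) : Module.Finite (D p) (integralClosure (D p) (K p)) :=
    finite_integralClosure_fractionRing k (D p) (K p)
  have (p : minimalPrimes R) : Module.Finite R (integralClosure (D p) (K p)) :=
    Module.Finite.trans (D p) _
  have hup (p : minimalPrimes R) : u ∉ p.1 := fun h =>
    notMem_nonZeroDivisors_of_mem_mem_minimalPrimes h p.2 hu
  have hunit (p : minimalPrimes R) : IsUnit (algebraMap R (K p) u) := by
    rw [isUnit_iff_ne_zero, IsScalarTower.algebraMap_apply R (D p) (K p)]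
    intro h0
    rw [FaithfulSMul.algebraMap_eq_zero_iff] at h0
    exact hup p (Ideal.Quotient.eq_zero_iff_mem.mp h0)
  let f (p : minimalPrimes R) : S →ₐ[R] K p :=
    { IsLocalization.Away.lift u (hunit p) with
      commutes' := fun r => IsLocalization.Away.lift_eq u (hunit p) r }
  let ψ : integralClosure R S →ₗ[R] ∀ p, integralClosure (D p) (K p) :=
    LinearMap.pi fun p =>
      { toFun := fun x => ⟨f p x, (x.2.map (f p)).tower_top⟩
        map_add' := fun x y => Subtype.ext (by simp)
        map_smul' := fun r x => Subtype.ext (by simp) }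
  refine Module.Finite.of_injective ψ ((injective_iff_map_eq_zero ψ).mpr fun x hx => ?_)
  have hx' (p : minimalPrimes R) : f p x = 0 :=
    congrArg (fun z => ((z p : integralClosure (D p) (K p)) : K p)) hx
  obtain ⟨n, r, hr⟩ := IsLocalization.Away.surj u (x : S)
  have hr0 : r = 0 := by
    refine IsNilpotent.eq_zero ?_
    rw [← mem_nilradical, nilradical, ← Ideal.sInf_minimalPrimes, Ideal.mem_sInf]
    intro p hpm
    have := congrArg (f ⟨p, hpm⟩) hr
    rw [map_mul, hx', zero_mul, AlgHom.commutes, IsScalarTower.algebraMap_apply R (D ⟨p, hpm⟩),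
      eq_comm, FaithfulSMul.algebraMap_eq_zero_iff] at this
    exact Ideal.Quotient.eq_zero_iff_mem.mp this
  rw [hr0, map_zero] at hr
  apply Subtype.ext
  exact ((IsLocalization.Away.algebraMap_isUnit (S := S) u).pow n).mul_left_eq_zero.mp hr

open TensorProduct in
-- Base change to the algebraic closure reduces to a perfect field. Smoothness of `S` keeps `S'`,
-- hence `R' ⊆ S'`, reduced. By flatness the base-changed closure embeds in the closure of `R'` in
-- `S'`, and finiteness descends along the faithfully flat `R → R'`.
theorem finite_integralClosure_of_smooth (k R S : Type u) [Field k] [CommRing R] [Algebra k R]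
    [Algebra.FiniteType k R] [CommRing S] [Algebra R S] [Algebra k S] [IsScalarTower k R S]
    [Algebra.Smooth k S] (u : R) (hu : u ∈ nonZeroDivisors R) [IsLocalization.Away u S] :
    Module.Finite R (integralClosure R S) := by
  let K := AlgebraicClosure k
  let R' := R ⊗[k] K
  let : Algebra K R' := Algebra.TensorProduct.rightAlgebra
  have : Algebra.FiniteType K R' := by
    have : Algebra.FiniteType K (K ⊗[k] R) := inferInstance
    refine this.equiv (AlgEquiv.ofRingEquiv (f := (Algebra.TensorProduct.comm k K R).toRingEquiv) ?_)
    intro x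
    rfl
  have : Module.FaithfullyFlat R R' := inferInstance
  let S' := R' ⊗[R] S
  have hRS : Function.Injective (algebraMap R S) :=
    IsLocalization.injective S (Submonoid.powers_le.mpr hu)
  have : IsLocalization.Away (algebraMap R R' u) S' := inferInstance
  have hu' : algebraMap R R' u ∈ nonZeroDivisors R' := by
    have h := Module.Flat.isSMulRegular_of_nonZeroDivisors (M := R') hu
    rw [mem_nonZeroDivisors_iff_right]
    intro x hx
    refine h.right_eq_zero_of_smul (x := x) ?_
    rw [Algebra.smul_def, mul_comm, hx]
  have hinj : Function.Injective (algebraMap R' S') :=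
    IsLocalization.injective S' (Submonoid.powers_le.mpr hu')
  have : IsReduced S' := by
    let e : S' ≃+* K ⊗[k] S :=
      ((Algebra.TensorProduct.comm R R' S).toRingEquiv.trans
        (Algebra.TensorProduct.cancelBaseChange k R R S K).toRingEquiv).trans
        (Algebra.TensorProduct.comm k S K).toRingEquiv
    have : IsReduced (K ⊗[k] S) := isReduced_of_smooth K _
    exact isReduced_of_injective e e.injective
  have : IsReduced R' := isReduced_of_injective _ hinj
  have : Module.Finite R' (integralClosure R' S') :=
    finite_integralClosure_of_perfectField K R' S' _ hu'
  have : IsNoetherianRing R' := Algebra.FiniteType.isNoetherianRing K R'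
  have : Module.Finite R' (R' ⊗[R] integralClosure R S) :=
    Module.Finite.of_injective (TensorProduct.toIntegralClosure R R' S).toLinearMap
      TensorProduct.toIntegralClosure_injective_of_flat
  exact Module.Finite.of_finite_tensorProduct_of_faithfullyFlat R'

end ReesClosure

/-! ### Asymptotic divisibility by a nonzerodivisor. -/

namespace ReesClosure

section Local

variable {B : Type*} [CommRing B] [IsLocalRing B] [IsNoetherianRing B] {π : B}

/-- By Krull's intersection theorem some power of `π` fails to divide `x`; take the last one that
does. -/
theorem exists_eq_pow_mul_unit (hπ : IsLocalRing.maximalIdeal B = Ideal.span {π}) {x : B}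
    (hx : x ≠ 0) : ∃ (v : ℕ) (w : B), IsUnit w ∧ x = π ^ v * w := by
  classical
  have h : ∃ n, ¬ π ^ n ∣ x := by
    by_contra! h
    refine hx ?_
    have : x ∈ ⨅ i : ℕ, IsLocalRing.maximalIdeal B ^ i := by
      rw [Ideal.mem_iInf]
      intro i
      rw [hπ, Ideal.span_singleton_pow, Ideal.mem_span_singleton]
      exact h i
    rwa [Ideal.iInf_pow_eq_bot_of_isLocalRing _ Ideal.IsPrime.ne_top'] at this
  obtain ⟨v, hv⟩ : ∃ v, Nat.find h = v + 1 := by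
    refine Nat.exists_eq_succ_of_ne_zero fun h0 => ?_
    have := Nat.find_spec h
    rw [h0] at this
    exact this (by simp)
  obtain ⟨w, hw⟩ := not_not.mp (Nat.find_min h (m := v) (by omega))
  refine ⟨v, w, ?_, hw⟩
  by_contra hwu
  have h1 : w ∈ IsLocalRing.maximalIdeal B := hwu
  rw [hπ, Ideal.mem_span_singleton] at h1
  obtain ⟨z, rfl⟩ := h1
  have := Nat.find_spec h
  rw [hv] at this
  exact this ⟨z, by rw [hw]; ring⟩

/-- If `x` has order `v`, the assumption says `e p ≤ v q`, so `s q < (v w + 1) q` and `s ≤ v w`. The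
exponent `e w` makes the order of the power a multiple of `e`, the order of `u`, so nothing is lost
to rounding. -/
theorem pow_dvd_pow_of_local (hπ : IsLocalRing.maximalIdeal B = Ideal.span {π}) {u ε : B} {e : ℕ}
    (hu : u ∈ nonZeroDivisors B) (hε : IsUnit ε) (he : 0 < e) (hue : u = π ^ e * ε)
    {x : B} {p q s w : ℕ} (hw : 0 < w) (h : u ^ p ∣ x ^ q)
    (hs : s * q < e * w * p + q) : u ^ s ∣ x ^ (e * w) := by
  by_cases hx : x = 0
  · rw [hx, zero_pow (Nat.mul_pos he hw).ne']; exact dvd_zero _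
  have hπ0 : π ∈ nonZeroDivisors B := by
    rw [hue] at hu
    have := (mul_mem_nonZeroDivisors.mp hu).1
    rw [mem_nonZeroDivisors_iff_right]
    intro x hx
    refine (mem_nonZeroDivisors_iff_right.mp this) x ?_
    rw [← Nat.sub_add_cancel he, pow_succ', ← mul_assoc, hx, zero_mul]
  obtain ⟨v, z, hz, rfl⟩ := exists_eq_pow_mul_unit hπ hx
  have hπu : ¬ IsUnit π := by
    have : π ∈ IsLocalRing.maximalIdeal B := by rw [hπ]; exact Ideal.mem_span_singleton_self _
    exact this
  have hle : e * p ≤ v * q := by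
    by_contra! hlt
    obtain ⟨y, hy⟩ := h
    have h1 : π ^ (v * q) * z ^ q = π ^ (v * q) * (π ^ (e * p - v * q) * (ε ^ p * y)) := by
      rw [← mul_assoc, ← pow_add, Nat.add_sub_cancel' hlt.le]
      rw [mul_pow, ← pow_mul, hue, mul_pow, ← pow_mul] at hy
      rw [hy]; ring
    have h2 := (mul_cancel_left_mem_nonZeroDivisors (pow_mem hπ0 _)).mp h1
    have h3 : IsUnit (π ^ (e * p - v * q)) := isUnit_of_mul_isUnit_left (h2 ▸ hz.pow q)
    exact hπu ((isUnit_pow_iff (by omega)).mp h3)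
  have hsv : s ≤ v * w := by
    by_contra! hlt
    have h1 : (v * w + 1) * q ≤ s * q := Nat.mul_le_mul_right q hlt
    have h2 : e * p * w ≤ v * q * w := Nat.mul_le_mul_right w hle
    nlinarith
  rw [hue, mul_pow, mul_pow, ← pow_mul, ← pow_mul]
  refine mul_dvd_mul (pow_dvd_pow _ ?_) ?_
  · calc e * s ≤ e * (v * w) := Nat.mul_le_mul_left e hsv
      _ = v * (e * w) := by ring
  · exact (hε.pow s).dvd

end Local

section Global

variable {C : Type*} [CommRing C] [IsNoetherianRing C]

/-- Divisibility by a power of a nonzerodivisor `u` is detected at the associated primes of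
`C ⧸ (u)`. -/
theorem pow_dvd_of_forall_associatedPrimes {u : C} (hu : u ∈ nonZeroDivisors C) (s : ℕ) (y : C)
    (h : ∀ (P : Ideal C) [P.IsPrime], P ∈ associatedPrimes C (C ⧸ Ideal.span {u}) →
      algebraMap C (Localization.AtPrime P) (u ^ s) ∣ algebraMap C (Localization.AtPrime P) y) :
    u ^ s ∣ y := by
  induction s generalizing y with
  | zero => simp
  | succ s ih =>
    have h1 : u ∣ y := by
      by_contra hy
      have hy0 : (Ideal.Quotient.mk (Ideal.span {u}) y) ≠ 0 := by
        rwa [Ne, Ideal.Quotient.eq_zero_iff_mem, Ideal.mem_span_singleton]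
      obtain ⟨P, hP, hle⟩ := exists_le_isAssociatedPrime_of_isNoetherianRing C _ hy0
      have := hP.isPrime
      obtain ⟨z, hz⟩ := h P hP
      obtain ⟨⟨a, t⟩, hat⟩ := IsLocalization.surj P.primeCompl z
      have h2 : algebraMap C (Localization.AtPrime P) (t * y) =
          algebraMap C (Localization.AtPrime P) (u ^ (s + 1) * a) := by
        rw [map_mul, hz, map_mul, ← hat]; ring
      obtain ⟨c, hc⟩ := (IsLocalization.eq_iff_exists P.primeCompl _).mp h2
      have h3 : (c * t : C) ∈ P := by
        apply hle
        rw [Submodule.mem_colon_singleton, Submodule.mem_bot]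
        change Ideal.Quotient.mk _ ((c * t : C) * y) = 0
        rw [Ideal.Quotient.eq_zero_iff_mem, Ideal.mem_span_singleton]
        refine ⟨u ^ s * c * a, ?_⟩
        rw [mul_assoc, hc]; ring
      exact (P.primeCompl.mul_mem c.2 t.2) h3
    obtain ⟨z, rfl⟩ := h1
    rw [pow_succ']
    refine mul_dvd_mul_left u (ih z fun P _ hP => ?_)
    obtain ⟨w, hw⟩ := h P hP
    refine ⟨w, ?_⟩
    have hu' : algebraMap C (Localization.AtPrime P) u ∈
        nonZeroDivisors (Localization.AtPrime P) :=
      IsLocalization.map_nonZeroDivisors_le P.primeCompl _ ⟨u, hu, rfl⟩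
    refine (mul_cancel_left_mem_nonZeroDivisors hu').mp ?_
    rw [← map_mul, hw, pow_succ', map_mul, mul_assoc]

variable {S : Type*} [CommRing S] [Algebra C S]

/-- Write `P = (u : c)` and `z = c/u`, so `zP ⊆ C`. If `zP ⊄ P`, some `x ∈ P` has `zx = t ∉ P`, and
`x` generates `P` locally. If `zP ⊆ P`, then `z` is integral, so `c ∈ (u)` and `P` is the whole
ring. -/
theorem exists_maximalIdeal_eq_span (hinj : Function.Injective (algebraMap C S))
    (hic : ∀ x : S, IsIntegral C x → x ∈ Set.range (algebraMap C S)) {u : C}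
    (hu : IsUnit (algebraMap C S u)) (P : Ideal C) [P.IsPrime]
    (hP : P ∈ associatedPrimes C (C ⧸ Ideal.span {u})) :
    ∃ π, IsLocalRing.maximalIdeal (Localization.AtPrime P) = Ideal.span {π} := by
  obtain ⟨-, c', hc'⟩ := isAssociatedPrime_iff.mp hP
  obtain ⟨c, rfl⟩ := Ideal.Quotient.mk_surjective c'
  have hPc (x : C) : x ∈ P ↔ u ∣ x * c := by
    rw [hc', Submodule.mem_colon_singleton, Submodule.mem_bot]
    change Ideal.Quotient.mk _ (x * c) = 0 ↔ _
    rw [Ideal.Quotient.eq_zero_iff_mem, Ideal.mem_span_singleton]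
  by_cases hcase : ∃ x t, x * c = u * t ∧ t ∉ P
  · obtain ⟨x, t, hxt, ht⟩ := hcase
    refine ⟨algebraMap C _ x, le_antisymm ?_ ?_⟩
    · rw [← IsLocalization.AtPrime.map_eq_maximalIdeal P, Ideal.map_le_iff_le_comap]
      intro y hy
      obtain ⟨t', ht'⟩ := (hPc y).mp hy
      have h1 : t * y = t' * x := by
        apply hinj
        rw [← hu.mul_right_inj, ← map_mul, ← map_mul]
        congr 1
        calc u * (t * y) = (u * t) * y := by ring
          _ = (y * c) * x := by rw [← hxt]; ring
          _ = _ := by rw [ht']; ring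
      have htu : IsUnit (algebraMap C (Localization.AtPrime P) t) :=
        IsLocalization.map_units _ (⟨t, ht⟩ : P.primeCompl)
      rw [Ideal.mem_comap, Ideal.mem_span_singleton, ← htu.dvd_mul_left, ← map_mul, h1, map_mul]
      exact dvd_mul_left _ _
    · rw [Ideal.span_singleton_le_iff_mem, IsLocalization.AtPrime.to_map_mem_maximal_iff _ P]
      exact (hPc x).mpr ⟨t, hxt⟩
  · exfalso
    push Not at hcase
    obtain ⟨i, hi⟩ := hu.exists_left_inv
    let z : S := i * algebraMap C S c
    -- `N = u⁻¹P` is finitely generated, contains `1` since `u ∈ P`, and is stable under `z`; so it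
    -- contains `C[z]`.
    let N : Submodule C S := Submodule.map ((LinearMap.mulLeft C i).comp (Algebra.linearMap C S)) P
    have hN : N.FG := (IsNoetherian.noetherian P).map _
    have huP : u ∈ P := (hPc u).mpr ⟨c, rfl⟩
    have hpow (n : ℕ) : z ^ n ∈ N := by
      induction n with
      | zero => exact ⟨u, huP, by simpa using hi⟩
      | succ n ih =>
        obtain ⟨x, hx, hxz⟩ := ih
        obtain ⟨t, ht⟩ := (hPc x).mp hx
        refine ⟨t, hcase x t ht, ?_⟩
        simp only [LinearMap.comp_apply, Algebra.linearMap_apply, LinearMap.mulLeft_apply] at hxz ⊢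
        have h2 := congrArg (algebraMap C S) ht
        rw [map_mul, map_mul] at h2
        calc i * algebraMap C S t = i * (i * algebraMap C S u) * algebraMap C S t := by rw [hi]; ring
          _ = i * i * (algebraMap C S u * algebraMap C S t) := by ring
          _ = z ^ (n + 1) := by rw [← h2, pow_succ, ← hxz]; simp only [z]; ring
    have hle : Subalgebra.toSubmodule (Algebra.adjoin C {z}) ≤ N := by
      rw [Algebra.adjoin_singleton_eq_range_aeval]
      rintro _ ⟨f, rfl⟩
      change Polynomial.aeval z f ∈ N
      rw [Polynomial.aeval_eq_sum_range]
      exact N.sum_mem fun j _ => N.smul_mem _ (hpow j)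
    have hz : IsIntegral C z := by
      refine IsIntegral.of_mem_of_fg (Algebra.adjoin C {z}) ?_ z
        (Algebra.self_mem_adjoin_singleton C z)
      have : IsNoetherian C N := isNoetherian_of_fg_of_noetherian N hN
      exact Submodule.FG.of_le hN hle
    obtain ⟨d, hd⟩ := hic z hz
    have : c = u * d := by
      apply hinj
      rw [map_mul, hd]
      simp only [z]
      rw [← mul_assoc, mul_comm _ i, hi, one_mul]
    refine Ideal.IsPrime.ne_top (I := P) inferInstance ?_
    rw [Ideal.eq_top_iff_one, hPc]
    exact ⟨d, by rw [one_mul, this]⟩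

/-- Asymptotic divisibility by `u` has bounded denominators in a Noetherian ring that is
integrally closed in `C[1/u]`. -/
theorem exists_pow_dvd_pow (hinj : Function.Injective (algebraMap C S))
    (hic : ∀ x : S, IsIntegral C x → x ∈ Set.range (algebraMap C S)) {u : C}
    (hu : IsUnit (algebraMap C S u)) :
    ∃ E : ℕ, 0 < E ∧ ∀ (x : C) (p q s : ℕ), u ^ p ∣ x ^ q → s * q < E * p + q →
      u ^ s ∣ x ^ E := by
  classical
  have hu0 : u ∈ nonZeroDivisors C := by
    rw [mem_nonZeroDivisors_iff_right]
    intro x hx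
    apply hinj
    rw [map_zero]
    refine hu.mul_left_eq_zero.mp ?_
    rw [← map_mul, hx, map_zero]
  let T := associatedPrimes C (C ⧸ Ideal.span {u})
  have hT : Finite T := associatedPrimes.finite C _
  let : Fintype T := Fintype.ofFinite T
  have hloc (P : T) : ∃ e : ℕ, 0 < e ∧ ∃ π ε : Localization.AtPrime P.1, IsUnit ε ∧
      IsLocalRing.maximalIdeal (Localization.AtPrime P.1) = Ideal.span {π} ∧
      algebraMap C _ u = π ^ e * ε := by
    obtain ⟨π, hπ⟩ := exists_maximalIdeal_eq_span hinj hic hu P.1 P.2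
    have huP : algebraMap C (Localization.AtPrime P.1) u ∈
        IsLocalRing.maximalIdeal (Localization.AtPrime P.1) := by
      rw [IsLocalization.AtPrime.to_map_mem_maximal_iff _ P.1]
      obtain ⟨-, c', hc'⟩ := isAssociatedPrime_iff.mp P.2
      obtain ⟨c, rfl⟩ := Ideal.Quotient.mk_surjective c'
      rw [hc', Submodule.mem_colon_singleton, Submodule.mem_bot]
      change Ideal.Quotient.mk _ (u * c) = 0
      rw [Ideal.Quotient.eq_zero_iff_mem, Ideal.mem_span_singleton]
      exact dvd_mul_right _ _
    have hune : algebraMap C (Localization.AtPrime P.1) u ≠ 0 :=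
      nonZeroDivisors.ne_zero (IsLocalization.map_nonZeroDivisors_le P.1.primeCompl _ ⟨u, hu0, rfl⟩)
    obtain ⟨e, ε, hε, h⟩ := exists_eq_pow_mul_unit hπ hune
    refine ⟨e, Nat.pos_of_ne_zero ?_, π, ε, hε, hπ, h⟩
    rintro rfl
    rw [pow_zero, one_mul] at h
    rw [h] at huP
    exact huP hε
  choose e he π ε hε hπ heq using hloc
  -- The product is a common multiple of the orders of `u`, so one exponent serves at every
  -- associated prime.
  refine ⟨∏ P, e P, Finset.prod_pos fun P _ => he P, fun x p q s hdvd hs => ?_⟩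
  refine pow_dvd_of_forall_associatedPrimes hu0 s _ fun P _ hP => ?_
  have hE : ∏ P, e P = e ⟨P, hP⟩ * ∏ Q ∈ Finset.univ.erase ⟨P, hP⟩, e Q :=
    (Finset.mul_prod_erase _ _ (Finset.mem_univ _)).symm
  rw [hE] at hs ⊢
  rw [map_pow, map_pow]
  refine pow_dvd_pow_of_local (hπ ⟨P, hP⟩)
    (IsLocalization.map_nonZeroDivisors_le P.primeCompl _ ⟨u, hu0, rfl⟩) (hε ⟨P, hP⟩)
    (he ⟨P, hP⟩) (heq ⟨P, hP⟩) (p := p) (q := q) (Finset.prod_pos fun Q _ => he Q) ?_ hs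
  rw [← map_pow, ← map_pow]
  exact map_dvd _ hdvd

end Global

end ReesClosure

/-! ### Rees algebras of filtrations and homogeneous integral elements. -/

namespace ReesClosure

open AddMonoidAlgebra

theorem coeff_single_mem {G A : Type*} [CommRing A] {I : G → Ideal A} {b : G} {f : A} (hf : f ∈ I b) (g : G) :
    (single b f : AddMonoidAlgebra A G).coeff g ∈ I g := by
  classical
  rw [coeff_single, Finsupp.single_apply]
  split_ifs with h
  · exact h ▸ hf
  · exact zero_mem _

section Filtration

variable {G A : Type*} [AddCommMonoid G] [CommRing A]

/-- A multiplicative family of ideals indexed by an additive monoid. -/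
structure IsFiltration (I : G → Ideal A) : Prop where
  zero : I 0 = ⊤
  mul : ∀ a b, I a * I b ≤ I (a + b)

/-- The subalgebra of `A[G]` generated by the homogeneous elements `f T^g` with `f ∈ I g`. -/
noncomputable def rees (I : G → Ideal A) : Subalgebra A (AddMonoidAlgebra A G) :=
  Algebra.adjoin A {p | ∃ g, ∃ f ∈ I g, p = single g f}

theorem single_mem_rees {I : G → Ideal A} {g : G} {f : A} (h : f ∈ I g) :
    single g f ∈ rees I :=
  Algebra.subset_adjoin ⟨g, f, h, rfl⟩

theorem coeff_mul_mem {I K L : G → Ideal A} (h : ∀ a b, I a * K b ≤ L (a + b))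
    {x y : AddMonoidAlgebra A G} (hx : ∀ g, x.coeff g ∈ I g) (hy : ∀ g, y.coeff g ∈ K g) (g : G) :
    (x * y).coeff g ∈ L g := by
  classical
  rw [AddMonoidAlgebra.coeff_mul]
  refine Ideal.sum_mem _ fun a _ => Ideal.sum_mem _ fun b _ => ?_
  dsimp only
  split_ifs with hab
  · exact hab ▸ h a b (Ideal.mul_mem_mul (hx a) (hy b))
  · exact zero_mem _

theorem coeff_mem_of_mem_adjoin {I : G → Ideal A} (hI : IsFiltration I)
    {s : Set (AddMonoidAlgebra A G)} (hs : ∀ p ∈ s, ∀ g, p.coeff g ∈ I g)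
    {p : AddMonoidAlgebra A G} (hp : p ∈ Algebra.adjoin A s) (g : G) : p.coeff g ∈ I g := by
  induction hp using Algebra.adjoin_induction generalizing g with
  | mem x hx => exact hs x hx g
  | algebraMap r =>
    exact coeff_single_mem (by rw [hI.zero]; trivial) g
  | add x y _ _ hx hy => exact add_mem (hx g) (hy g)
  | mul x y _ _ hx hy => exact coeff_mul_mem hI.mul hx hy g

theorem coeff_mem_of_mem_rees {I : G → Ideal A} (hI : IsFiltration I)
    {p : AddMonoidAlgebra A G} (hp : p ∈ rees I) (g : G) : p.coeff g ∈ I g := by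
  refine coeff_mem_of_mem_adjoin hI ?_ hp g
  rintro _ ⟨b, f, hf, rfl⟩ g
  exact coeff_single_mem hf g

/-- The elements `f` such that `f T^g` is integral over the Rees algebra of `I`. -/
noncomputable def intCl (I : G → Ideal A) (g : G) : Ideal A where
  carrier := {f | IsIntegral (rees I) (single g f : AddMonoidAlgebra A G)}
  zero_mem' := by
    simpa using (isIntegral_zero (R := rees I) (B := AddMonoidAlgebra A G))
  add_mem' := fun {a b} ha hb => by
    change IsIntegral _ _
    rw [AddMonoidAlgebra.single_add]
    exact IsIntegral.add ha hb
  smul_mem' := fun r f hf => by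
    change IsIntegral _ _
    have h : (single g (r • f) : AddMonoidAlgebra A G) =
      algebraMap (rees I) _ (algebraMap A (rees I) r) * single g f := by
      rw [← AddMonoidAlgebra.smul_single, Algebra.smul_def]; rfl
    rw [h]
    exact isIntegral_algebraMap.mul hf

theorem mem_intCl {I : G → Ideal A} {g : G} {f : A} :
    f ∈ intCl I g ↔ IsIntegral (rees I) (single g f : AddMonoidAlgebra A G) := Iff.rfl

theorem le_intCl (I : G → Ideal A) (g : G) : I g ≤ intCl I g := fun _ hf =>
  isIntegral_algebraMap (R := rees I) (x := ⟨_, single_mem_rees hf⟩)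

theorem mul_mem_intCl {I : G → Ideal A} {a b : G} {x y : A} (hx : x ∈ intCl I a)
    (hy : y ∈ intCl I b) : x * y ∈ intCl I (a + b) := by
  rw [mem_intCl, ← single_mul_single]
  exact IsIntegral.mul hx hy

theorem pow_mem_intCl {I : G → Ideal A} {a : G} {x : A} (hx : x ∈ intCl I a) (n : ℕ) :
    x ^ n ∈ intCl I (n • a) := by
  rw [mem_intCl, ← single_pow]
  exact IsIntegral.pow hx n

theorem mem_intCl_of_pow_mem {I : G → Ideal A}
    {g : G} {x : A} {n : ℕ} (hn : 0 < n) (h : x ^ n ∈ intCl I (n • g)) : x ∈ intCl I g := by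
  refine IsIntegral.of_pow hn ?_
  rw [single_pow]
  exact h

theorem IsFiltration.intCl {I : G → Ideal A} (hI : IsFiltration I) :
    IsFiltration (intCl I) where
  zero := top_le_iff.mp (hI.zero ▸ le_intCl I 0)
  mul := fun _ _ => Ideal.mul_le.mpr fun _ hx _ hy => mul_mem_intCl hx hy

end Filtration

theorem mem_intCl_of_equation {G A : Type*} [AddCommMonoid G] [CommRing A] {I : G → Ideal A}
    {g : G} {f : A} {m : ℕ} {c : ℕ → A} (hc : ∀ i ∈ Finset.Icc 1 m, c i ∈ I (i • g))
    (h : f ^ m + ∑ i ∈ Finset.Icc 1 m, c i * f ^ (m - i) = 0) : f ∈ intCl I g := by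
  classical
  -- The coefficient `c i` is placed in degree `i • g`, which makes the equation homogeneous of
  -- degree `m • g`. The value `0` is never used.
  let d (i : ℕ) : rees I := if hi : i ∈ Finset.Icc 1 m then ⟨_, single_mem_rees (hc i hi)⟩ else 0
  refine ⟨Polynomial.X ^ m + ∑ i ∈ Finset.Icc 1 m,
    Polynomial.C (d i) * Polynomial.X ^ (m - i), ?_, ?_⟩
  · apply Polynomial.monic_X_pow_add
    rw [← Polynomial.mem_degreeLT]
    refine Submodule.sum_mem _ fun i hi => ?_
    rw [Polynomial.mem_degreeLT]
    refine (Polynomial.degree_C_mul_X_pow_le _ _).trans_lt ?_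
    have := Finset.mem_Icc.mp hi
    exact_mod_cast (by omega : m - i < m)
  · rw [Polynomial.eval₂_add, Polynomial.eval₂_finsetSum]
    simp only [Polynomial.eval₂_mul, Polynomial.eval₂_C, Polynomial.eval₂_X_pow]
    have key : ∀ i ∈ Finset.Icc 1 m, algebraMap (rees I) (AddMonoidAlgebra A G) (d i) *
        single g f ^ (m - i) = single (m • g) (c i * f ^ (m - i)) := by
      intro i hi
      have h1 : algebraMap (rees I) (AddMonoidAlgebra A G) (d i) = single (i • g) (c i) := by
        simp only [d, dif_pos hi]; rfl
      have := Finset.mem_Icc.mp hi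
      rw [h1, single_pow, single_mul_single, ← add_smul, Nat.add_sub_cancel' this.2]
    rw [Finset.sum_congr rfl key, single_pow]
    have := congrArg (AddMonoidAlgebra.singleAddHom (m • g)) h
    rw [map_add, map_sum, map_zero] at this
    exact this

/-- Take the component of degree `m • g` of a monic equation. Cancellation in `G` ensures that only
the degree `(m - i) • g` part of the coefficient of `X^i` contributes. -/
theorem exists_equation_of_mem_intCl {G A : Type*} [AddCancelCommMonoid G] [CommRing A]
    {I : G → Ideal A} (hI : IsFiltration I) {g : G} {f : A} (h : f ∈ intCl I g) :
    ∃ (m : ℕ) (c : ℕ → A), (∀ i, c i ∈ I (i • g)) ∧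
      f ^ m + ∑ i ∈ Finset.Icc 1 m, c i * f ^ (m - i) = 0 := by
  obtain ⟨p, hp, h0⟩ := h
  set m := p.natDegree
  refine ⟨m, fun i => (p.coeff (m - i) : AddMonoidAlgebra A G).coeff (i • g),
    fun i => coeff_mem_of_mem_rees hI (p.coeff (m - i)).2 _, ?_⟩
  have h1 : ∀ i ∈ Finset.range (m + 1),
      ((p.coeff i : AddMonoidAlgebra A G) * single g f ^ i).coeff (m • g) =
        (p.coeff i : AddMonoidAlgebra A G).coeff ((m - i) • g) * f ^ i := by
    intro i hi
    rw [single_pow]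
    refine coeff_mul_single_eq_coeff_mul _ fun a _ => ?_
    have : (m - i) • g + i • g = m • g := by
      rw [← add_smul, Nat.sub_add_cancel (Finset.mem_range_succ_iff.mp hi)]
    rw [← this, add_left_inj]
  rw [Polynomial.eval₂_eq_sum_range] at h0
  have h2 := congrArg ((Finsupp.applyAddHom (m • g)).comp
    (AddMonoidAlgebra.coeffAddEquiv (R := A) (M := G)).toAddMonoidHom) h0
  rw [map_sum, map_zero] at h2
  have h3 : ∑ i ∈ Finset.range (m + 1),
      (p.coeff i : AddMonoidAlgebra A G).coeff ((m - i) • g) * f ^ i = 0 := by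
    rw [← h2]
    exact Finset.sum_congr rfl fun i hi => (h1 i hi).symm
  rw [← Finset.sum_range_reflect, Finset.sum_range_succ'] at h3
  have h4 : (p.coeff m : AddMonoidAlgebra A G).coeff 0 = 1 := by
    have : p.coeff m = 1 := hp
    rw [this, OneMemClass.coe_one, AddMonoidAlgebra.one_def, coeff_single, Finsupp.single_eq_same]
  rw [← h3, add_comm, Finset.range_eq_Ico, Finset.sum_Ico_add' (fun j =>
    (p.coeff (m + 1 - 1 - j) : AddMonoidAlgebra A G).coeff ((m - (m + 1 - 1 - j)) • g) *
      f ^ (m + 1 - 1 - j)) 0 m 1]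
  congr 1
  · refine Finset.sum_congr rfl fun i hi => ?_
    have := Finset.mem_Icc.mp hi
    rw [Nat.add_sub_cancel, Nat.sub_sub_self this.2]
  · simp [h4]

end ReesClosure

/-! ### Degrees in `(1/N)ℤ` and the extended Rees algebra. -/

namespace ReesClosure

open AddMonoidAlgebra QRees

variable {A : Type*} [CommRing A]

/-- The members of index in `(1/N)ℕ` of a family of ideals, extended by `J 0` to negative indices. -/
def lattice (J : ℚ≥0 → Ideal A) (N : ℕ) (n : ℤ) : Ideal A := J (n.toNat / N)

theorem lattice_isFiltration {J : ℚ≥0 → Ideal A} (hJ : IsFiltration J)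
    (hanti : ∀ a b, a ≤ b → J b ≤ J a) (N : ℕ) : IsFiltration (lattice J N) where
  zero := by simp [lattice, hJ.zero]
  mul := fun a b => (hJ.mul _ _).trans <| hanti _ _ <| by
    rw [← add_div]
    gcongr
    have : (a + b).toNat ≤ a.toNat + b.toNat := by omega
    exact_mod_cast this

theorem mem_lattice_of_nonpos {J : ℚ≥0 → Ideal A} (hJ : J 0 = ⊤) (N : ℕ) {n : ℤ} (hn : n ≤ 0)
    (x : A) : x ∈ lattice J N n := by
  simp [lattice, Int.toNat_of_nonpos hn, hJ]

theorem lattice_nsmul (J : ℚ≥0 → Ideal A) (N i n : ℕ) :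
    lattice J N (i • (n : ℤ)) = J (i • ((n : ℚ≥0) / N)) := by
  have : (i • (n : ℤ)).toNat = i * n := by rw [nsmul_eq_mul]; exact_mod_cast Int.toNat_natCast _
  rw [lattice, this, nsmul_eq_mul, Nat.cast_mul, mul_div_assoc]

/-- A homogeneous equation only involves the ideals at multiples of its degree, and these agree for
the two gradings. -/
theorem intCl_lattice {J : ℚ≥0 → Ideal A} (hJ : IsFiltration J)
    (hanti : ∀ a b, a ≤ b → J b ≤ J a) (N n : ℕ) :
    intCl (lattice J N) n = intCl J (n / N) := by
  ext f
  constructor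
  · intro h
    obtain ⟨m, c, hc, h⟩ := exists_equation_of_mem_intCl (lattice_isFiltration hJ hanti N) h
    exact mem_intCl_of_equation (fun i _ => lattice_nsmul J N i n ▸ hc i) h
  · intro h
    obtain ⟨m, c, hc, h⟩ := exists_equation_of_mem_intCl hJ h
    exact mem_intCl_of_equation (fun i _ => (lattice_nsmul J N i n).symm ▸ hc i) h

theorem intCl_anti {J : ℚ≥0 → Ideal A} (hJ : IsFiltration J)
    (hanti : ∀ a b, a ≤ b → J b ≤ J a) {a b : ℚ≥0} (hab : a ≤ b) : intCl J b ≤ intCl J a := by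
  intro f h
  obtain ⟨m, c, hc, h⟩ := exists_equation_of_mem_intCl hJ h
  exact mem_intCl_of_equation (fun i _ => hanti _ _ (nsmul_le_nsmul_right hab i) (hc i)) h

/-- The ideal generated by the products of the `f i` of total degree at least `a`. -/
def prodIdeal {ι : Type*} (f : ι → A) (d : ι → ℚ≥0) (a : ℚ≥0) : Ideal A :=
  Ideal.span {g | ∃ l : List ι, a ≤ (l.map d).sum ∧ g = (l.map f).prod}

section prodIdeal

variable {ι : Type*} {f : ι → A} {d : ι → ℚ≥0}

theorem prod_mem_prodIdeal (l : List ι) {a : ℚ≥0} (h : a ≤ (l.map d).sum) :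
    (l.map f).prod ∈ prodIdeal f d a := Ideal.subset_span ⟨l, h, rfl⟩

theorem mem_prodIdeal (i : ι) : f i ∈ prodIdeal f d (d i) := by
  simpa using prod_mem_prodIdeal (f := f) (d := d) [i] (a := d i) (by simp)

theorem prodIdeal_anti {a b : ℚ≥0} (h : a ≤ b) : prodIdeal f d b ≤ prodIdeal f d a :=
  Ideal.span_mono fun _ ⟨l, hl, hg⟩ => ⟨l, h.trans hl, hg⟩

theorem prodIdeal_isFiltration : IsFiltration (prodIdeal f d) where
  zero := by
    rw [Ideal.eq_top_iff_one]
    exact prod_mem_prodIdeal [] (by simp)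
  mul := fun a b => by
    rw [prodIdeal, prodIdeal, Ideal.span_mul_span', Ideal.span_le]
    rintro _ ⟨_, ⟨l, hl, rfl⟩, _, ⟨l', hl', rfl⟩, rfl⟩
    refine Ideal.subset_span ⟨l ++ l', ?_, by simp⟩
    rw [List.map_append, List.sum_append]
    exact add_le_add hl hl'

theorem prodIdeal_le {J : ℚ≥0 → Ideal A} (hJ : IsFiltration J)
    (hanti : ∀ a b, a ≤ b → J b ≤ J a) (h : ∀ i, f i ∈ J (d i)) (a : ℚ≥0) :
    prodIdeal f d a ≤ J a := by
  rw [prodIdeal, Ideal.span_le]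
  rintro _ ⟨l, hl, rfl⟩
  refine hanti _ _ hl ?_
  clear hl
  induction l with
  | nil => simp [hJ.zero]
  | cons i l ih =>
    simp only [List.map_cons, List.prod_cons, List.sum_cons]
    exact hJ.mul _ _ (Ideal.mul_mem_mul (h i) ih)

theorem prodIdeal_le_comp {κ : Type*} {f' : κ → A} {d' : κ → ℚ≥0} (φ : ι → κ)
    (hf : ∀ i, f' (φ i) = f i) (hd : ∀ i, d' (φ i) = d i) (a : ℚ≥0) :
    prodIdeal f d a ≤ prodIdeal f' d' a := by
  refine prodIdeal_le prodIdeal_isFiltration (fun _ _ => prodIdeal_anti) (fun i => ?_) a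
  rw [← hf, ← hd]
  exact mem_prodIdeal _

end prodIdeal

theorem isQReesRing_of_finite {A : Type u} [CommRing A] {J : ℚ≥0 → Ideal A} (hJ : IsFiltration J)
    (hanti : ∀ a b, a ≤ b → J b ≤ J a) {ι : Type*} [Finite ι] (f : ι → A) (d : ι → ℚ≥0)
    (hf : ∀ i, f i ∈ J (d i)) (h : ∀ a, J a ≤ prodIdeal f d a) : IsQReesRing J where
  zero := hJ.zero
  mul := hJ.mul
  anti := hanti
  fg := by
    obtain ⟨n, ⟨e⟩⟩ := Finite.exists_equiv_fin ι
    refine ⟨n, f ∘ e.symm, d ∘ e.symm, fun i => hf _, fun a => le_antisymm ?_ ?_⟩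
    · exact (h a).trans (prodIdeal_le_comp e (by simp) (by simp) a)
    · exact prodIdeal_le hJ hanti (f := f ∘ e.symm) (d := d ∘ e.symm) (fun i => hf _) a

theorem _root_.QRees.IsQReesRing.isFiltration {A : Type u} [CommRing A] {J : ℚ≥0 → Ideal A}
    (h : IsQReesRing J) : IsFiltration J := ⟨h.zero, h.mul⟩

/-- Generators are the `f i T^(e i)` and `T⁻¹`; the latter lowers a product of excessive degree to
the required one. -/
theorem rees_lattice_fg {ι : Type*} [Finite ι] {f : ι → A} {d : ι → ℚ≥0} {N : ℕ} (hN : 0 < N)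
    {e : ι → ℕ} (he : ∀ i, d i = e i / N) :
    (rees (lattice (prodIdeal f d) N)).FG := by
  classical
  let u : AddMonoidAlgebra A ℤ := single (-1) 1
  let s : Set (AddMonoidAlgebra A ℤ) := insert u (Set.range fun i => single (e i : ℤ) (f i))
  have hs : s.Finite := (Set.finite_range _).insert _
  rw [Subalgebra.fg_def]
  refine ⟨s, hs, le_antisymm (Algebra.adjoin_le ?_) (Algebra.adjoin_le ?_)⟩
  · rintro _ (rfl | ⟨i, rfl⟩)
    · exact single_mem_rees (mem_lattice_of_nonpos prodIdeal_isFiltration.zero N (by simp) 1)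
    · refine single_mem_rees ?_
      simp only [lattice, Int.toNat_natCast, ← he]
      exact mem_prodIdeal i
  · rintro _ ⟨n, c, hc, rfl⟩
    have hu : u ∈ Algebra.adjoin A s := Algebra.subset_adjoin (Set.mem_insert _ _)
    rw [lattice, prodIdeal] at hc
    induction hc using Submodule.span_induction with
    | zero => simp [single_zero]
    | add x y _ _ hx hy => rw [single_add]; exact add_mem hx hy
    | smul r x _ hx => rw [← smul_single]; exact Subalgebra.smul_mem _ hx r
    | mem x hx =>
      obtain ⟨l, hl, rfl⟩ := hx
      have h1 (l : List ι) : single ((l.map e).sum : ℤ) (l.map f).prod ∈ Algebra.adjoin A s := by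
        induction l with
        | nil => exact one_mem _
        | cons i l ih =>
          have : (single (((i :: l).map e).sum : ℤ) ((i :: l).map f).prod : AddMonoidAlgebra A ℤ) =
              single (e i : ℤ) (f i) * single ((l.map e).sum : ℤ) (l.map f).prod := by
            rw [single_mul_single]; simp
          rw [this]
          exact mul_mem (Algebra.subset_adjoin (Set.mem_insert_of_mem _ ⟨i, rfl⟩)) ih
      have h2 : (l.map d).sum = (l.map e).sum / (N : ℚ≥0) := by
        clear hl
        induction l with
        | nil => simp
        | cons i l ih => simp [ih, he, add_div]
      rw [h2] at hl
      have h3 : n.toNat ≤ (l.map e).sum := by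
        have := (div_le_div_iff_of_pos_right (by positivity : (0 : ℚ≥0) < N)).mp hl
        exact_mod_cast this
      have h4 : n ≤ (l.map e).sum := (Int.self_le_toNat n).trans (by exact_mod_cast h3)
      obtain ⟨m, hm⟩ := Int.eq_ofNat_of_zero_le (sub_nonneg.mpr h4)
      have h5 : (single n (l.map f).prod : AddMonoidAlgebra A ℤ) =
          single ((l.map e).sum : ℤ) (l.map f).prod * u ^ m := by
        simp only [u, single_pow, single_mul_single, one_pow, mul_one]
        congr 1
        rw [nsmul_eq_mul]; omega
      rw [h5]
      exact mul_mem (h1 l) (pow_mem hu m)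

section Laurent

variable {I : ℤ → Ideal A} (hI : ∀ n ≤ 0, I n = ⊤)

/-- The element `T⁻¹` of the extended Rees algebra. -/
noncomputable def invT : rees I :=
  ⟨single (-1) 1, single_mem_rees (by rw [hI _ (by simp)]; trivial)⟩

theorem invT_pow (n : ℕ) :
    ((invT hI ^ n : rees I) : AddMonoidAlgebra A ℤ) = single (-(n : ℤ)) 1 := by
  rw [SubmonoidClass.coe_pow, invT, single_pow]
  simp

theorem isUnit_invT : IsUnit (algebraMap (rees I) (AddMonoidAlgebra A ℤ) (invT hI)) :=
  IsUnit.of_mul_eq_one (single 1 1) (by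
    change single (-1) 1 * _ = _
    rw [single_mul_single, neg_add_cancel, one_mul]; rfl)

/-- A large power of `T⁻¹` moves any Laurent polynomial into nonpositive degrees, where `I` is the
unit ideal. -/
theorem isLocalization_invT : IsLocalization.Away (invT hI) (AddMonoidAlgebra A ℤ) := by
  rw [IsLocalization.Away, isLocalization_iff]
  refine ⟨?_, fun z => ?_, fun {x y} h => ⟨1, by rw [Subtype.ext h]⟩⟩
  · rintro ⟨_, n, rfl⟩
    rw [map_pow]
    exact (isUnit_invT hI).pow n
  · suffices ∃ n : ℕ, z * single (-(n : ℤ)) 1 ∈ rees I by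
      obtain ⟨n, hn⟩ := this
      exact ⟨⟨⟨_, hn⟩, ⟨_, n, rfl⟩⟩, by
        change z * ((invT hI ^ n : rees I) : AddMonoidAlgebra A ℤ) = _
        rw [invT_pow]; rfl⟩
    have hmono (n m : ℕ) (z) (h : z * single (-(n : ℤ)) 1 ∈ rees I) :
        z * single (-((n + m : ℕ) : ℤ)) 1 ∈ rees I := by
      have : (single (-((n + m : ℕ) : ℤ)) 1 : AddMonoidAlgebra A ℤ) =
          single (-(n : ℤ)) 1 * ((invT hI ^ m : rees I) : AddMonoidAlgebra A ℤ) := by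
        rw [invT_pow, single_mul_single]; congr 1
        · push_cast; ring
        · simp
      rw [this, ← mul_assoc]
      exact mul_mem h (invT hI ^ m).2
    induction z using AddMonoidAlgebra.induction_linear with
    | zero => exact ⟨0, by simp⟩
    | add x y hx hy =>
      obtain ⟨n, hn⟩ := hx
      obtain ⟨m, hm⟩ := hy
      refine ⟨n + m, ?_⟩
      rw [add_mul]
      refine add_mem (hmono n m x hn) ?_
      rw [add_comm]
      exact hmono m n y hm
    | single a c =>
      refine ⟨a.toNat, ?_⟩
      rw [single_mul_single]
      refine single_mem_rees ?_
      rw [hI _ (by omega)]; trivial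

theorem invT_mem_nonZeroDivisors : invT hI ∈ nonZeroDivisors (rees I) := by
  rw [mem_nonZeroDivisors_iff_right]
  intro x hx
  apply Subtype.ext
  refine (isUnit_invT hI).mul_left_eq_zero.mp ?_
  exact congrArg Subtype.val hx

end Laurent

theorem smooth_laurent (k A : Type u) [Field k] [CommRing A] [Algebra k A] [Algebra.Smooth k A] :
    Algebra.Smooth k (AddMonoidAlgebra A ℤ) := by
  have : IsScalarTower A (Polynomial A) (LaurentPolynomial A) :=
    IsScalarTower.of_algebraMap_eq fun x => (Polynomial.toLaurent_C x).symm
  have : Algebra.Smooth A (Polynomial A) := {}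
  have : Algebra.Smooth (Polynomial A) (LaurentPolynomial A) :=
    Algebra.Smooth.of_isLocalization_Away (Polynomial.X : Polynomial A)
  have h2 : Algebra.Smooth A (LaurentPolynomial A) := Algebra.Smooth.comp A (Polynomial A) _
  have : Algebra.Smooth A (AddMonoidAlgebra A ℤ) := h2
  exact Algebra.Smooth.comp k A _

end ReesClosure

/-! ### Bounded denominators and finite generation of the integral closure. -/

namespace ReesClosure

open AddMonoidAlgebra QRees

theorem finite_integralClosure_rees (k : Type u) {A : Type u} [Field k] [CommRing A] [Algebra k A]
    [Algebra.Smooth k A] {I : ℤ → Ideal A} (hI : ∀ n ≤ 0, I n = ⊤) (hfg : (rees I).FG) :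
    IsNoetherianRing (rees I) ∧
      Module.Finite (rees I) (_root_.integralClosure (rees I) (AddMonoidAlgebra A ℤ)) := by
  have : Algebra.FiniteType A (rees I) := (rees I).fg_iff_finiteType.mp hfg
  have : Algebra.FiniteType k (rees I) := Algebra.FiniteType.trans (S := A) inferInstance this
  have : Algebra.Smooth k (AddMonoidAlgebra A ℤ) := smooth_laurent k A
  have : IsScalarTower k (rees I) (AddMonoidAlgebra A ℤ) :=
    IsScalarTower.of_algebraMap_eq fun _ => rfl
  have := isLocalization_invT hI
  exact ⟨Algebra.FiniteType.isNoetherianRing k _,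
    finite_integralClosure_of_smooth k (rees I) (AddMonoidAlgebra A ℤ) (invT hI)
      (invT_mem_nonZeroDivisors hI)⟩

theorem exists_common_denominator {ι : Type*} [Finite ι] (d : ι → ℚ≥0) :
    ∃ N : ℕ, 0 < N ∧ ∃ e : ι → ℕ, ∀ i, d i = e i / N := by
  classical
  let : Fintype ι := Fintype.ofFinite ι
  refine ⟨∏ i, (d i).den, Finset.prod_pos fun i _ => (d i).den_pos,
    fun i => (d i).num * ∏ j ∈ Finset.univ.erase i, (d j).den, fun i => ?_⟩
  rw [← Finset.mul_prod_erase _ _ (Finset.mem_univ i)]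
  push_cast
  rw [mul_div_mul_right, NNRat.num_div_den]
  exact Finset.prod_ne_zero_iff.mpr fun j _ => by exact_mod_cast (d j).den_ne_zero

/-- In `C`, having `x T^n` is the same as divisibility of `x` by `u^n`, where `u = T⁻¹`. For `x`
integral in degree `a`, clearing the denominator of `a` gives `u^(a.num * N) ∣ x^a.den`. Bounded
denominators then give `u^s ∣ x^E` with `s = ⌈aEN⌉`, and an `E`-th root places `x` in degree
`s/(EN)`. -/
theorem exists_intCl_le_intCl_ceil (k : Type u) {A : Type u} [Field k] [CommRing A] [Algebra k A]
    [Algebra.Smooth k A] {J : ℚ≥0 → Ideal A} (hJ : IsQReesRing J) :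
    ∃ (r : ℕ) (f : Fin r → A) (d : Fin r → ℚ≥0) (M : ℕ) (e : Fin r → ℕ), 0 < M ∧
      (∀ i, d i = e i / M) ∧ (J = prodIdeal f d) ∧
      ∀ a, intCl J a ≤ intCl J (⌈a * M⌉₊ / M) := by
  obtain ⟨r, f, d, -, hspan⟩ := hJ.fg
  have hJf : J = prodIdeal f d := funext hspan
  obtain ⟨N, hN, e, he⟩ := exists_common_denominator d
  have hI : ∀ n ≤ 0, lattice J N n = ⊤ := fun n hn =>
    (Ideal.eq_top_iff_one _).mpr (mem_lattice_of_nonpos hJ.zero N hn 1)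
  have hfg : (rees (lattice J N)).FG := hJf ▸ rees_lattice_fg hN he
  obtain ⟨hnoeth, hfin⟩ := finite_integralClosure_rees k hI hfg
  let R := rees (lattice J N)
  let S := AddMonoidAlgebra A ℤ
  let C := _root_.integralClosure R S
  have : IsNoetherianRing C := IsNoetherianRing.of_finite R C
  have hic : ∀ x : S, IsIntegral C x → x ∈ Set.range (algebraMap C S) := fun x hx =>
    ⟨⟨x, isIntegral_trans (R := R) (A := C) x hx⟩, rfl⟩
  let u : C := algebraMap R C (invT hI)
  obtain ⟨E, hE, h⟩ := exists_pow_dvd_pow (S := S) (u := u) Subtype.val_injective hic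
    (isUnit_invT hI)
  have hu (n : ℕ) : ((u ^ n : C) : S) = single (-(n : ℤ)) 1 := by
    rw [← invT_pow hI n]; rfl
  have hmem (n : ℕ) (x : A) : x ∈ intCl J (n / N) ↔ (single (n : ℤ) x : S) ∈ C := by
    rw [← intCl_lattice hJ.isFiltration hJ.anti]; rfl
  refine ⟨r, f, d, E * N, fun i => E * e i, Nat.mul_pos hE hN, fun i => ?_, hJf, fun a x hx => ?_⟩
  · rw [he]; push_cast
    rw [mul_div_mul_left]
    exact_mod_cast hE.ne'
  set s := ⌈a * (E * N : ℕ)⌉₊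
  have hNQ : (N : ℚ≥0) ≠ 0 := by exact_mod_cast hN.ne'
  have hEQ : (E : ℚ≥0) ≠ 0 := by exact_mod_cast hE.ne'
  have hxq : (single ((a.num * N : ℕ) : ℤ) (x ^ a.den) : S) ∈ C := by
    rw [← hmem]
    convert pow_mem_intCl hx a.den using 2
    push_cast
    rw [mul_div_cancel_right₀ _ hNQ, nsmul_eq_mul, mul_comm, NNRat.mul_den_eq_num]
  let x' : C := algebraMap A C x
  have hx' (n : ℕ) : ((x' ^ n : C) : S) = single 0 (x ^ n) := by
    have : ((x' : C) : S) = single 0 x := rfl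
    rw [SubmonoidClass.coe_pow, this, single_pow, smul_zero]
  have hdvd : u ^ (a.num * N) ∣ x' ^ a.den := by
    refine ⟨⟨_, hxq⟩, Subtype.ext ?_⟩
    rw [MulMemClass.coe_mul, hu, hx', single_mul_single, neg_add_cancel, one_mul]
  -- Rounding up costs less than `1`, which is exactly the slack allowed by `exists_pow_dvd_pow`.
  have hs : s * a.den < E * (a.num * N) + a.den := by
    have h1 : (s : ℚ≥0) < a * (E * N : ℕ) + 1 := Nat.ceil_lt_add_one zero_le
    have h2 : (s : ℚ≥0) * a.den < (a * (E * N : ℕ) + 1) * a.den :=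
      mul_lt_mul_of_pos_right h1 (by exact_mod_cast a.den_pos)
    have h3 : (a * (E * N : ℕ) + 1) * a.den = E * (a.num * N) + a.den := by
      rw [← NNRat.mul_den_eq_num a]; push_cast; ring
    rw [h3] at h2
    exact_mod_cast h2
  obtain ⟨y, hy⟩ := h x' _ _ s hdvd hs
  have hy' : (single (s : ℤ) (x ^ E) : S) = y := by
    have h1 : (single 0 (x ^ E) : S) = single (-(s : ℤ)) 1 * (y : S) := by
      rw [← hx', hy, MulMemClass.coe_mul, hu]
    calc (single (s : ℤ) (x ^ E) : S) = single (s : ℤ) 1 * single 0 (x ^ E) := by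
          rw [single_mul_single, add_zero, one_mul]
      _ = y := by rw [h1, ← mul_assoc, single_mul_single, add_neg_cancel, one_mul]; exact one_mul _
  have hxE : x ^ E ∈ intCl J (s / N) := by
    rw [hmem, hy']; exact y.2
  refine mem_intCl_of_pow_mem hE ?_
  have hEs : E • ((s : ℚ≥0) / (E * N : ℕ)) = s / N := by
    rw [nsmul_eq_mul]; push_cast
    field_simp
  rw [hEs]
  exact hxE

theorem isQReesRing_intCl (k : Type u) {A : Type u} [Field k] [CommRing A] [Algebra k A]
    [Algebra.Smooth k A] {J : ℚ≥0 → Ideal A} (hJ : IsQReesRing J) :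
    IsQReesRing (intCl J) := by
  classical
  obtain ⟨r, f, d, M, e, hM, he, hJf, hceil⟩ := exists_intCl_le_intCl_ceil k hJ
  have hI : ∀ n ≤ 0, lattice J M n = ⊤ := fun n hn =>
    (Ideal.eq_top_iff_one _).mpr (mem_lattice_of_nonpos hJ.zero M hn 1)
  have hfg : (rees (lattice J M)).FG := hJf ▸ rees_lattice_fg hM he
  obtain ⟨hnoeth, hfin⟩ := finite_integralClosure_rees k hI hfg
  let R := rees (lattice J M)
  let S := AddMonoidAlgebra A ℤ
  let C := _root_.integralClosure R S
  have hMQ : (0 : ℚ≥0) < M := by exact_mod_cast hM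
  let B : Set S := {p | ∃ n : ℕ, ∃ g ∈ intCl J (n / M), p = single (n : ℤ) g}
  have hBC : Submodule.span R B ≤ Subalgebra.toSubmodule C := by
    rw [Submodule.span_le]
    rintro _ ⟨n, g, hg, rfl⟩
    rw [← intCl_lattice hJ.isFiltration hJ.anti] at hg
    exact hg
  have hBfg : (Submodule.span R B).FG := by
    have : IsNoetherian R (Subalgebra.toSubmodule C) :=
      isNoetherian_of_isNoetherianRing_of_finite R C
    exact Submodule.FG.of_le_of_isNoetherian hBC
  -- Choosing the generators inside `B` makes them homogeneous; with the original `f` they become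
  -- algebra generators.
  obtain ⟨t, htB, ht⟩ := (Submodule.fg_span_iff_fg_span_finset_subset B).mp hBfg
  choose n g hg hng using htB
  let f' : Fin r ⊕ t → A := Sum.elim f fun p => g p.2
  let d' : Fin r ⊕ t → ℚ≥0 := Sum.elim d fun p => n p.2 / M
  have hJle (a : ℚ≥0) : J a ≤ prodIdeal f' d' a :=
    (congrFun hJf a).le.trans (prodIdeal_le_comp (f := f) (d := d) (f' := f') (d' := d') Sum.inl
      (fun _ => rfl) (fun _ => rfl) a)
  have hanti {a b : ℚ≥0} (h : a ≤ b) : intCl J b ≤ intCl J a :=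
    intCl_anti hJ.isFiltration hJ.anti h
  have hLat := lattice_isFiltration hJ.isFiltration hJ.anti M
  have hQlat := lattice_isFiltration (prodIdeal_isFiltration (f := f') (d := d'))
    (fun _ _ => prodIdeal_anti) M
  have hspan (x : S) (hx : x ∈ Submodule.span R (t : Set S)) (m : ℤ) :
      x.coeff m ∈ lattice (prodIdeal f' d') M m := by
    induction hx using Submodule.span_induction generalizing m with
    | zero => exact zero_mem _
    | add x y _ _ hx hy => exact add_mem (hx m) (hy m)
    | smul c x _ hx =>
      have hcx : c • x = (c : S) * x := rfl
      have hc (j : ℤ) : (c : S).coeff j ∈ lattice (prodIdeal f' d') M j :=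
        hJle _ (coeff_mem_of_mem_rees hLat c.2 j)
      rw [hcx]
      exact coeff_mul_mem hQlat.mul hc hx m
    | mem x hx =>
      rw [hng hx]
      refine coeff_single_mem ?_ m
      have := mem_prodIdeal (f := f') (d := d') (Sum.inr ⟨x, hx⟩)
      simpa [lattice, f', d'] using this
  refine isQReesRing_of_finite hJ.isFiltration.intCl (fun _ _ => hanti) f' d' ?_ fun a x hx => ?_
  · rintro (i | p)
    · refine le_intCl J _ ?_
      exact (congrFun hJf (d i)).ge (mem_prodIdeal i)
    · exact hg p.2
  -- An arbitrary rational degree is first rounded up to the lattice, where the module generators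
  -- apply.
  · have h1 := hceil a hx
    have h2 : (single ((⌈a * M⌉₊ : ℕ) : ℤ) x : S) ∈ Submodule.span R (t : Set S) :=
      ht ▸ Submodule.subset_span ⟨_, x, h1, rfl⟩
    have h3 := hspan _ h2 (⌈a * M⌉₊ : ℕ)
    rw [coeff_single, Finsupp.single_eq_same, lattice, Int.toNat_natCast] at h3
    refine prodIdeal_anti ?_ h3
    rw [le_div_iff₀ hMQ]
    exact Nat.le_ceil _

end ReesClosure

/-! ### Integral closure and localization. -/

namespace ReesClosure

variable {G A B : Type*} [AddCancelCommMonoid G] [CommRing A] [CommRing B]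

theorem map_intCl_le {I : G → Ideal A} {K : G → Ideal B} (hI : IsFiltration I) (φ : A →+* B)
    (h : ∀ g, (I g).map φ ≤ K g) (g : G) : (intCl I g).map φ ≤ intCl K g := by
  rw [Ideal.map_le_iff_le_comap]
  intro f hf
  obtain ⟨m, c, hc, h0⟩ := exists_equation_of_mem_intCl hI hf
  refine mem_intCl_of_equation (m := m) (c := fun i => φ (c i))
    (fun i _ => h _ (Ideal.mem_map_of_mem φ (hc i))) ?_
  have := congrArg φ h0
  simpa only [map_add, map_sum, map_mul, map_pow, map_zero] using this

/-- Multiplying the equation by `s^(M(m-1))` makes it monic in `s^M f`. -/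
theorem pow_mul_mem_intCl {I : G → Ideal A} {g : G} {s f : A} {M m : ℕ} {c : ℕ → A}
    (hc : ∀ i ∈ Finset.Icc 1 m, c i ∈ I (i • g))
    (h : s ^ M * f ^ m + ∑ i ∈ Finset.Icc 1 m, c i * f ^ (m - i) = 0) :
    s ^ M * f ∈ intCl I g := by
  rcases m with _ | m
  · have : s ^ M = 0 := by simpa using h
    rw [this, zero_mul]
    exact zero_mem _
  refine mem_intCl_of_equation (m := m + 1) (c := fun i => s ^ (M * (i - 1)) * c i)
    (fun i hi => Ideal.mul_mem_left _ _ (hc i hi)) ?_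
  have h1 : ∀ i ∈ Finset.Icc 1 (m + 1),
      s ^ (M * (i - 1)) * c i * (s ^ M * f) ^ (m + 1 - i) =
        s ^ (M * m) * (c i * f ^ (m + 1 - i)) := by
    intro i hi
    have hi := Finset.mem_Icc.mp hi
    have h2 : m = (i - 1) + (m + 1 - i) := by omega
    have h3 : s ^ (M * m) = s ^ (M * (i - 1)) * s ^ (M * (m + 1 - i)) := by
      rw [← pow_add, ← mul_add, ← h2]
    rw [mul_pow, ← pow_mul, h3]; ring
  rw [Finset.sum_congr rfl h1, ← Finset.mul_sum]
  have h4 : (s ^ M * f) ^ (m + 1) = s ^ (M * m) * (s ^ M * f ^ (m + 1)) := by ring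
  rw [h4, ← mul_add, h, mul_zero]

/-- For the harder inclusion, clear denominators in an integral equation over `B`. The result holds
in `A` up to a power of `s`, which `pow_mul_mem_intCl` absorbs. -/
theorem map_intCl_of_isLocalization [Algebra A B] {I : G → Ideal A} {K : G → Ideal B}
    (hI : IsFiltration I) (hK : IsFiltration K) (s : A) [IsLocalization.Away s B]
    (h : ∀ g, (I g).map (algebraMap A B) = K g) (g : G) :
    (intCl I g).map (algebraMap A B) = intCl K g := by
  refine le_antisymm (map_intCl_le hI _ (fun g => (h g).le) g) fun x hx => ?_
  obtain ⟨n, f, hf⟩ := IsLocalization.Away.surj s x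
  have hsu : IsUnit (algebraMap A B s) := IsLocalization.Away.algebraMap_isUnit s
  have hfx : algebraMap A B f ∈ intCl K g := hf ▸ Ideal.mul_mem_right _ _ hx
  obtain ⟨m, c, hc, h0⟩ := exists_equation_of_mem_intCl hK hfx
  have h1 (i : ℕ) : ∃ (y : A) (n : ℕ), y ∈ I (i • g) ∧ c i * algebraMap A B s ^ n = algebraMap A B y := by
    have := hc i
    rw [← h, IsLocalization.mem_map_algebraMap_iff (Submonoid.powers s)] at this
    obtain ⟨⟨⟨y, hy⟩, ⟨_, n, rfl⟩⟩, hyn⟩ := this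
    exact ⟨y, n, hy, by simpa using hyn⟩
  choose y l hy hyl using h1
  let N := ∑ i ∈ Finset.Icc 1 m, l i
  have h2 : algebraMap A B (s ^ N * f ^ m +
      ∑ i ∈ Finset.Icc 1 m, s ^ (N - l i) * y i * f ^ (m - i)) = 0 := by
    simp only [map_add, map_sum, map_mul, map_pow, ← hyl]
    have : ∀ i ∈ Finset.Icc 1 m,
        algebraMap A B s ^ (N - l i) * (c i * algebraMap A B s ^ l i) * algebraMap A B f ^ (m - i) =
          algebraMap A B s ^ N * (c i * algebraMap A B f ^ (m - i)) := by
      intro i hi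
      have hle : l i ≤ N := Finset.single_le_sum (f := l) (fun _ _ => Nat.zero_le _) hi
      conv_rhs => rw [← Nat.sub_add_cancel hle, pow_add]
      ring
    rw [Finset.sum_congr rfl this, ← Finset.mul_sum, ← mul_add, h0, mul_zero]
  rw [IsLocalization.map_eq_zero_iff (Submonoid.powers s)] at h2
  obtain ⟨⟨_, r, rfl⟩, h3⟩ := h2
  have h4 : s ^ (r + N) * f ∈ intCl I g := by
    refine pow_mul_mem_intCl (m := m) (c := fun i => s ^ r * (s ^ (N - l i) * y i))
      (fun i _ => Ideal.mul_mem_left _ _ (Ideal.mul_mem_left _ _ (hy i))) ?_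
    rw [← h3, mul_add, Finset.mul_sum, pow_add]
    simp only [mul_assoc]
  have h5 : algebraMap A B (s ^ (r + N) * f) ∈ (intCl I g).map (algebraMap A B) :=
    Ideal.mem_map_of_mem _ h4
  rw [map_mul, map_pow, ← hf, mul_comm x, ← mul_assoc, ← pow_add] at h5
  exact (Ideal.unit_mul_mem_iff_mem _ (hsu.pow _)).mp h5

theorem map_intCl_of_isLocalization' {I : G → Ideal A} {K : G → Ideal B}
    (hI : IsFiltration I) (hK : IsFiltration K) (s : A) (φ : A →+* B)
    (hφ : @IsLocalization.Away A _ s B _ φ.toAlgebra) (h : ∀ g, (I g).map φ = K g) (g : G) :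
    (intCl I g).map φ = intCl K g :=
  @map_intCl_of_isLocalization G A B _ _ _ φ.toAlgebra I K hI hK s hφ h g

end ReesClosure

/-! ### Integral elements and asymptotic order. -/

namespace ReesClosure

open QRees

/-- Any `b < a` with `⌈bM⌉ = ⌈aM⌉` works; there is room because `a` exceeds `(⌈aM⌉ - 1)/M`. -/
theorem exists_lt_intCl_le (k : Type u) {A : Type u} [Field k] [CommRing A] [Algebra k A]
    [Algebra.Smooth k A] {J : ℚ≥0 → Ideal A} (hJ : IsQReesRing J) {a : ℚ≥0} (ha : 0 < a) :
    ∃ b < a, intCl J b ≤ intCl J a := by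
  obtain ⟨-, -, -, M, -, hM, -, -, h⟩ := exists_intCl_le_intCl_ceil k hJ
  have hMQ : (0 : ℚ≥0) < M := by exact_mod_cast hM
  obtain ⟨s, hs⟩ : ∃ s, ⌈a * M⌉₊ = s + 1 :=
    Nat.exists_eq_succ_of_ne_zero (Nat.ceil_pos.mpr (mul_pos ha hMQ)).ne'
  have h1 : (s : ℚ≥0) / M < a := by
    rw [div_lt_iff₀ hMQ, ← Nat.lt_ceil, hs]
    exact Nat.lt_succ_self s
  obtain ⟨b, hb1, hb2⟩ := exists_between h1
  refine ⟨b, hb2, (h b).trans (intCl_anti hJ.isFiltration hJ.anti ?_)⟩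
  rw [div_lt_iff₀ hMQ, ← Nat.lt_ceil] at hb1
  rw [le_div_iff₀ hMQ]
  calc a * M ≤ ⌈a * M⌉₊ := Nat.le_ceil _
    _ ≤ ⌈b * M⌉₊ := by rw [hs]; exact_mod_cast hb1

/-- Substitute the equation into `f^(m+n)` by strong induction on `n`. Terms with `i > n` need no
induction, since `c i` already lies in `J_{ia} ⊆ J_{na}`. -/
theorem exists_pow_mem_of_mem_intCl {A : Type*} [CommRing A] {J : ℚ≥0 → Ideal A}
    (hJ : IsFiltration J) (hanti : ∀ a b, a ≤ b → J b ≤ J a) {a : ℚ≥0} {f : A}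
    (hf : f ∈ intCl J a) : ∃ m : ℕ, ∀ n : ℕ, f ^ (m + n) ∈ J (n • a) := by
  obtain ⟨m, c, hc, h⟩ := exists_equation_of_mem_intCl hJ hf
  refine ⟨m, fun n => ?_⟩
  induction n using Nat.strong_induction_on with
  | _ n ih =>
    have h1 : f ^ (m + n) = -∑ i ∈ Finset.Icc 1 m, c i * f ^ (m - i + n) := by
      rw [eq_neg_iff_add_eq_zero, ← mul_zero (f ^ n), ← h, mul_add, Finset.mul_sum, pow_add]
      congr 1
      · ring
      · exact Finset.sum_congr rfl fun i _ => by rw [pow_add]; ring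
    rw [h1]
    refine neg_mem (Ideal.sum_mem _ fun i hi => ?_)
    have hi := Finset.mem_Icc.mp hi
    by_cases hin : i ≤ n
    · have h2 := ih (n - i) (by omega)
      have h3 := hJ.mul _ _ (Ideal.mul_mem_mul (hc i) h2)
      rw [← add_smul, Nat.add_sub_cancel' hin] at h3
      rwa [show m - i + n = m + (n - i) by omega]
    · exact Ideal.mul_mem_right _ _ (hanti _ _ (nsmul_le_nsmul_left zero_le (by omega)) (hc i))

theorem tendsto_natDiv_div_atTop {k : ℕ} (hk : 0 < k) :
    Tendsto (fun n : ℕ => ((n / k : ℕ) : ℝ≥0∞) / n) atTop (𝓝 (k : ℝ≥0∞)⁻¹) := by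
  have h1 : Tendsto (fun n : ℕ => (⌊(k : ℝ)⁻¹ * (n : ℝ)⌋₊ : ℝ) / n) atTop (𝓝 (k : ℝ)⁻¹) :=
    (tendsto_nat_floor_mul_div_atTop (R := ℝ) (by positivity)).comp tendsto_natCast_atTop_atTop
  have h2 := ENNReal.tendsto_ofReal h1
  have hk' : (0 : ℝ) < k := by exact_mod_cast hk
  rw [ENNReal.ofReal_inv_of_pos hk', ENNReal.ofReal_natCast] at h2
  refine h2.congr' ?_
  filter_upwards [eventually_gt_atTop 0] with n hn
  have hn' : (0 : ℝ) < n := by exact_mod_cast hn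
  rw [ENNReal.ofReal_div_of_pos hn', ENNReal.ofReal_natCast, ENNReal.ofReal_natCast,
    mul_comm, ← div_eq_mul_inv, Nat.floor_div_eq_div]

/-- Fekete's lemma with values in `[0, ∞]`: the limit is the supremum, approached by dividing `n` by
a fixed `k`. -/
theorem exists_tendsto_div_of_superadditive {v : ℕ → ℝ≥0∞} (hv : ∀ m n, v m + v n ≤ v (m + n)) :
    ∃ L, Tendsto (fun n : ℕ => v n / n) atTop (𝓝 L) ∧ ∀ n, 0 < n → v n / n ≤ L := by
  refine ⟨⨆ n : {n : ℕ // 0 < n}, v n / (n : ℕ), ?_, fun n hn =>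
    le_iSup (fun n : {n : ℕ // 0 < n} => v n / (n : ℕ)) ⟨n, hn⟩⟩
  have hmul (k q r : ℕ) : q * v k ≤ v (q * k + r) := by
    induction q generalizing r with
    | zero => simp
    | succ q ih =>
      calc ((q + 1 : ℕ) : ℝ≥0∞) * v k = q * v k + v k := by push_cast; ring
        _ ≤ v (q * k + r) + v k := by gcongr; exact ih r
        _ ≤ v (q * k + r + k) := hv _ _
        _ = v ((q + 1) * k + r) := by congr 1; ring
  refine tendsto_order.2 ⟨fun c hc => ?_, fun c hc => ?_⟩
  · obtain ⟨⟨k, hk⟩, hck⟩ := lt_iSup_iff.mp hc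
    have h1 : Tendsto (fun n : ℕ => (((n / k : ℕ) : ℝ≥0∞) / n) * v k) atTop
        (𝓝 ((k : ℝ≥0∞)⁻¹ * v k)) := by
      refine ENNReal.Tendsto.mul_const ?_ (Or.inl (by simp))
      exact tendsto_natDiv_div_atTop hk
    rw [mul_comm, ← div_eq_mul_inv] at h1
    filter_upwards [h1.eventually (lt_mem_nhds hck)] with n hn
    refine hn.trans_le ?_
    rw [mul_comm, ← mul_div_assoc, mul_comm]
    gcongr
    calc ((n / k : ℕ) : ℝ≥0∞) * v k ≤ v (n / k * k + n % k) := hmul _ _ _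
      _ = v n := by rw [Nat.div_add_mod']
  · filter_upwards [eventually_gt_atTop 0] with n hn
    exact (le_iSup (fun n : {n : ℕ // 0 < n} => v n / (n : ℕ)) ⟨n, hn⟩).trans_lt hc

theorem le_of_forall_mul_le_div {a : ℝ≥0} {L : ℝ≥0∞} (m : ℕ)
    (h : ∀ n : ℕ, 0 < n → (n : ℝ≥0∞) * a / (m + n : ℕ) ≤ L) : (a : ℝ≥0∞) ≤ L := by
  have h1 : Tendsto (fun n : ℕ => ((n / (n + m : ℝ) : ℝ))) atTop (𝓝 1) :=
    tendsto_natCast_div_add_atTop (m : ℝ)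
  have h2 := ENNReal.Tendsto.mul_const (b := (a : ℝ≥0∞)) (ENNReal.tendsto_ofReal h1)
    (Or.inl (by simp))
  rw [ENNReal.ofReal_one, one_mul] at h2
  refine le_of_tendsto h2 ?_
  filter_upwards [eventually_gt_atTop 0] with n hn
  refine le_trans (le_of_eq ?_) (h n hn)
  have hpos : (0 : ℝ) < n + m := by positivity
  rw [ENNReal.ofReal_div_of_pos hpos, ENNReal.ofReal_natCast, add_comm (n : ℝ), ← Nat.cast_add,
    ENNReal.ofReal_natCast, div_eq_mul_inv, div_eq_mul_inv, mul_right_comm]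

end ReesClosure

/-! ### Passage to ideal sheaves on the scheme. -/

namespace QRees

open ReesClosure

variable {W : Scheme.{u}}

section Sheaf

/-- Restriction as a ring homomorphism. -/
noncomputable def resHom {U V : W.Opens} (h : V ≤ U) : Γ(W, U) →+* Γ(W, V) :=
  (W.presheaf.map (homOfLE h).op).hom

theorem resHom_apply {U V : W.Opens} (h : V ≤ U) (f : Γ(W, U)) : resHom h f = res h f := rfl

theorem res_self {U : W.Opens} (f : Γ(W, U)) : res le_rfl f = f := by
  simp [res]

theorem res_res {U V V' : W.Opens} (h : V ≤ U) (h' : V' ≤ V) (f : Γ(W, U)) :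
    res h' (res h f) = res (h'.trans h) f := by
  simp only [res, ← CommRingCat.comp_apply, ← Functor.map_comp]
  rfl

theorem germ_resHom {U V : W.Opens} (h : V ≤ U) (x : W) (hx : x ∈ V) (f : Γ(W, U)) :
    W.presheaf.germ V x hx (resHom h f) = W.presheaf.germ U x (h hx) f :=
  W.presheaf.germ_res_apply (homOfLE h) x hx f

theorem exists_affine_le {U : W.Opens} {x : W} (hx : x ∈ U) :
    ∃ V : W.affineOpens, x ∈ V.1 ∧ V.1 ≤ U := by
  obtain ⟨_, ⟨V, hV, rfl⟩, hxV, hVU⟩ :=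
    W.isBasis_affineOpens.exists_subset_of_mem_open hx U.2
  exact ⟨⟨V, hV⟩, hxV, hVU⟩

variable (I : W.IdealSheafData)

theorem resHom_mem {U V : W.affineOpens} (h : V.1 ≤ U.1) {f : Γ(W, U.1)} (hf : f ∈ I.ideal U) :
    resHom h f ∈ I.ideal V :=
  I.ideal_le_comap_ideal (U := V) (V := U) h hf

theorem map_resHom {U V : W.affineOpens} (h : V.1 ≤ U.1) :
    (I.ideal U).map (resHom h) = I.ideal V :=
  I.map_ideal (U := V) (V := U) h

theorem map_germ_of_le {U V : W.affineOpens} (h : V.1 ≤ U.1) (x : W) (hx : x ∈ V.1) :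
    (I.ideal V).map (W.presheaf.germ V.1 x hx).hom =
      (I.ideal U).map (W.presheaf.germ U.1 x (h hx)).hom := by
  rw [← map_resHom I h, Ideal.map_map]
  congr 1
  ext f
  exact germ_resHom h x hx f

theorem map_germ_eq (U V : W.affineOpens) (x : W) (hU : x ∈ U.1) (hV : x ∈ V.1) :
    (I.ideal V).map (W.presheaf.germ V.1 x hV).hom =
      (I.ideal U).map (W.presheaf.germ U.1 x hU).hom := by
  obtain ⟨V', hx, hle⟩ := exists_affine_le (U := U.1 ⊓ V.1) ⟨hU, hV⟩
  rw [← map_germ_of_le I (hle.trans inf_le_left) x hx,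
    ← map_germ_of_le I (hle.trans inf_le_right) x hx]

/-- Membership in an ideal sheaf is local. -/
theorem mem_ideal_of_locally (U : W.affineOpens) (f : Γ(W, U.1))
    (h : ∀ x ∈ U.1, ∃ (V : W.affineOpens) (hV : V.1 ≤ U.1), x ∈ V.1 ∧ res hV f ∈ I.ideal V) :
    f ∈ I.ideal U := by
  rw [U.2.mem_ideal_iff]
  intro x hx
  obtain ⟨V, hV, hxV, hf⟩ := h x hx
  rw [← map_germ_of_le I hV x hxV, ← germ_resHom hV x hxV]
  exact Ideal.mem_map_of_mem _ hf

theorem mem_sections_iff (U : W.affineOpens) (f : Γ(W, U.1)) :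
    f ∈ sections I U.1 ↔ f ∈ I.ideal U := by
  refine ⟨fun h => ?_, fun h V hV => resHom_mem I hV h⟩
  have := h U le_rfl
  rwa [res_self] at this

end Sheaf

section Generated

/-- Being a filtration, `K` already contains all products of generators, and membership is local.
Only affine sections of `K` need to lie in `S`, so `S` itself need not be a sheaf. -/
theorem generated_eq {K : ℚ≥0 → W.IdealSheafData} (hK : ∀ U, IsFiltration fun a => (K a).ideal U)
    {S : GradedFamily W} (h₁ : ∀ a U, S a U ⊆ sections (K a) U)
    (h₂ : ∀ a (U : W.affineOpens) f, f ∈ (K a).ideal U → f ∈ S a U.1) :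
    (fun a U => sections (K a) U) = generated S := by
  funext a U
  ext f
  constructor
  · intro hf x hx
    obtain ⟨V, hxV, hV⟩ := exists_affine_le hx
    exact ⟨V.1, hV, hxV, Algebra.subset_adjoin ⟨a, _, h₂ a V _ (hf V hV), rfl⟩⟩
  · intro hf V hVU
    refine mem_ideal_of_locally _ _ _ fun x hx => ?_
    obtain ⟨V', hV', hxV', hmem⟩ := hf x (hVU hx)
    obtain ⟨V'', hxV'', hle⟩ := exists_affine_le (U := V.1 ⊓ V') ⟨hx, hxV'⟩
    refine ⟨V'', hle.trans inf_le_left, hxV'', ?_⟩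
    let φ := resHom (hle.trans inf_le_right : V''.1 ≤ V')
    have hfil : IsFiltration fun b => ((K b).ideal V'').comap φ :=
      { zero := by rw [(hK V'').zero, Ideal.comap_top]
        mul := fun b c => Ideal.mul_le.mpr fun x hx y hy => by
          rw [Ideal.mem_comap, map_mul]
          exact (hK V'').mul b c (Ideal.mul_mem_mul hx hy) }
    have key := coeff_mem_of_mem_adjoin hfil ?_ hmem a
    · rw [AddMonoidAlgebra.coeff_single, Finsupp.single_eq_same] at key
      rw [res_res]
      have h3 : φ (res hV' f) = res (hle.trans inf_le_right |>.trans hV') f := res_res _ _ _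
      rw [Ideal.mem_comap, h3] at key
      exact key
    · rintro _ ⟨b, g, hg, rfl⟩ c
      refine coeff_single_mem (I := fun b => ((K b).ideal V'').comap φ) ?_ c
      exact h₁ b V' hg V'' (hle.trans inf_le_right)

end Generated

section Closure

variable (𝒥 : QReesAlgebra W)

theorem QReesAlgebra.isFiltration (U : W.affineOpens) : IsFiltration fun a => (𝒥.J a).ideal U where
  zero := by rw [𝒥.zero]; rfl
  mul := fun a b => 𝒥.mul a b U

theorem QReesAlgebra.ideal_anti (U : W.affineOpens) {a b : ℚ≥0} (h : a ≤ b) :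
    (𝒥.J b).ideal U ≤ (𝒥.J a).ideal U := 𝒥.anti a b h U

/-- The ideal sheaf of all `f` such that `f T^a` is integral over `𝒥`. -/
noncomputable def intClSheaf (a : ℚ≥0) : W.IdealSheafData where
  ideal U := intCl (fun b => (𝒥.J b).ideal U) a
  map_ideal_basicOpen U f :=
    map_intCl_of_isLocalization' (𝒥.isFiltration U) (𝒥.isFiltration (W.affineBasicOpen f)) f
      (W.presheaf.map (homOfLE <| W.basicOpen_le f).op).hom (U.2.isLocalization_basicOpen f)
      (fun g => (𝒥.J g).map_ideal_basicOpen U f) a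

theorem intClSheaf_ideal (a : ℚ≥0) (U : W.affineOpens) :
    (intClSheaf 𝒥 a).ideal U = intCl (fun b => (𝒥.J b).ideal U) a := rfl

/-- The integral closure of `𝒥` as a `ℚ`-Rees algebra. -/
noncomputable def intClAlgebra (h : ∀ U : W.affineOpens, IsQReesRing (fun a => (𝒥.J a).ideal U) →
    IsQReesRing (intCl fun a => (𝒥.J a).ideal U)) : QReesAlgebra W where
  J := intClSheaf 𝒥
  zero := by
    ext1
    funext U
    exact (𝒥.isFiltration U).intCl.zero
  mul := fun a b U => (𝒥.isFiltration U).intCl.mul a b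
  anti := fun a b hab U => intCl_anti (𝒥.isFiltration U) (fun _ _ => 𝒥.ideal_anti U) hab
  fg := by
    obtain ⟨C, hC, hfg⟩ := 𝒥.fg
    exact ⟨C, hC, fun U hU => h U (hfg U hU)⟩

theorem isIntegralElem_subset (a : ℚ≥0) (U : W.Opens) :
    {f | IsIntegralElem 𝒥 a U f} ⊆ sections (intClSheaf 𝒥 a) U := by
  rintro f ⟨m, c, hc, h⟩ V hV
  rw [intClSheaf_ideal]
  refine mem_intCl_of_equation (m := m) (c := fun i => resHom hV (c i)) (fun i hi => ?_) ?_
  · rw [nsmul_eq_mul]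
    exact hc i hi V hV
  · have := congrArg (resHom hV) h
    simpa only [map_add, map_sum, map_mul, map_pow, map_zero, ← resHom_apply] using this

theorem isIntegralElem_of_mem (a : ℚ≥0) (U : W.affineOpens) (f : Γ(W, U.1))
    (hf : f ∈ (intClSheaf 𝒥 a).ideal U) : IsIntegralElem 𝒥 a U.1 f := by
  obtain ⟨m, c, hc, h⟩ := exists_equation_of_mem_intCl (𝒥.isFiltration U) hf
  refine ⟨m, c, fun i _ => ?_, h⟩
  rw [mem_sections_iff, ← nsmul_eq_mul]
  exact hc i

theorem stalk_anti {a b : ℚ≥0} (h : a ≤ b) (ξ : W) : stalk (𝒥.J b) ξ ⊆ stalk (𝒥.J a) ξ := by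
  rintro _ ⟨V, hV, g, hg, rfl⟩
  exact ⟨V, hV, g, 𝒥.ideal_anti V h hg, rfl⟩

theorem mul_mem_stalk {a b : ℚ≥0} {ξ : W} {x y : W.presheaf.stalk ξ} (hx : x ∈ stalk (𝒥.J a) ξ)
    (hy : y ∈ stalk (𝒥.J b) ξ) : x * y ∈ stalk (𝒥.J (a + b)) ξ := by
  obtain ⟨V, hV, g, hg, rfl⟩ := hx
  obtain ⟨V', hV', g', hg', rfl⟩ := hy
  obtain ⟨V'', hx, hle⟩ := exists_affine_le (U := V.1 ⊓ V'.1) ⟨hV, hV'⟩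
  refine ⟨V'', hx, resHom (hle.trans inf_le_left) g * resHom (hle.trans inf_le_right) g',
    𝒥.mul a b V'' (Ideal.mul_mem_mul (resHom_mem _ _ hg) (resHom_mem _ _ hg')), ?_⟩
  rw [map_mul, germ_resHom, germ_resHom]

theorem mem_stalk_zero {ξ : W} (x : W.presheaf.stalk ξ) : x ∈ stalk (𝒥.J 0) ξ := by
  obtain ⟨U, hξ, g, rfl⟩ := W.presheaf.exists_germ_eq x
  obtain ⟨V, hξV, hV⟩ := exists_affine_le hξ
  refine ⟨V, hξV, resHom hV g, ?_, germ_resHom hV ξ hξV g⟩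
  rw [(𝒥.isFiltration V).zero]
  trivial

theorem le_nu {a : ℚ≥0} {ξ : W} {x : W.presheaf.stalk ξ} (h : x ∈ stalk (𝒥.J a) ξ) :
    ((a : ℝ≥0) : ℝ≥0∞) ≤ nu 𝒥 ξ x :=
  le_iSup₂_of_le a h le_rfl

theorem nu_add_le {ξ : W} (x y : W.presheaf.stalk ξ) :
    nu 𝒥 ξ x + nu 𝒥 ξ y ≤ nu 𝒥 ξ (x * y) := by
  refine ENNReal.biSup_add_biSup_le ⟨0, mem_stalk_zero 𝒥 x⟩ ⟨0, mem_stalk_zero 𝒥 y⟩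
    fun a ha b hb => ?_
  have := le_nu 𝒥 (mul_mem_stalk 𝒥 ha hb)
  refine le_trans (le_of_eq ?_) this
  push_cast
  rfl

theorem isRadicalElem_of_mem (a : ℚ≥0) (U : W.affineOpens) (f : Γ(W, U.1))
    (hf : f ∈ (intClSheaf 𝒥 a).ideal U) : IsRadicalElem 𝒥 a U.1 f := by
  intro ξ hξ
  set x := W.presheaf.germ U.1 ξ hξ f
  obtain ⟨L, hL, hle⟩ := exists_tendsto_div_of_superadditive (v := fun n => nu 𝒥 ξ (x ^ n))
    fun m n => by rw [pow_add]; exact nu_add_le 𝒥 _ _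
  refine ⟨L, hL, ?_⟩
  obtain ⟨m, hm⟩ := exists_pow_mem_of_mem_intCl (𝒥.isFiltration U)
    (fun _ _ => 𝒥.ideal_anti U) hf
  refine le_of_forall_mul_le_div m fun n hn => le_trans ?_ (hle (m + n) (by omega))
  gcongr
  have hmem : x ^ (m + n) ∈ stalk (𝒥.J (n • a)) ξ := ⟨U, hξ, _, hm n, map_pow _ _ _⟩
  have := le_nu 𝒥 hmem
  refine le_trans (le_of_eq ?_) this
  rw [nsmul_eq_mul]
  push_cast
  rfl

/-- Near `ξ`, a limit exceeding `b` produces `f^n ∈ J_{nb}` with `n > 0`, so `f` is integral in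
degree `b`. The `b < a` supplied by `hlt` upgrades this to degree `a` in the stalk, and stalks
determine the ideal. -/
theorem isRadicalElem_subset
    (hlt : ∀ U : W.affineOpens, IsQReesRing (fun a => (𝒥.J a).ideal U) → ∀ a, 0 < a →
      ∃ b < a, intCl (fun a => (𝒥.J a).ideal U) b ≤ intCl (fun a => (𝒥.J a).ideal U) a)
    (a : ℚ≥0) (U : W.Opens) :
    {f | IsRadicalElem 𝒥 a U f} ⊆ sections (intClSheaf 𝒥 a) U := by
  intro f hf V hV
  -- Degree `0` is separate: no `b < 0` exists, but the closure there is everything.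
  rcases eq_or_ne a 0 with rfl | ha
  · rw [intClSheaf_ideal, (𝒥.isFiltration V).intCl.zero]
    trivial
  rw [V.2.mem_ideal_iff]
  intro ξ hξ
  obtain ⟨C, hC, hfg⟩ := 𝒥.fg
  obtain ⟨U', hU', hξU'⟩ := hC ξ
  obtain ⟨b, hba, hb⟩ := hlt U' (hfg U' hU') a (pos_iff_ne_zero.mpr ha)
  obtain ⟨L, hL, haL⟩ := hf ξ (hV hξ)
  have hbL : ((b : ℝ≥0) : ℝ≥0∞) < L := lt_of_lt_of_le (by exact_mod_cast hba) haL
  obtain ⟨n, hn, hn0⟩ :=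
    ((hL.eventually (lt_mem_nhds hbL)).and (eventually_gt_atTop 0)).exists
  rw [ENNReal.lt_div_iff_mul_lt (Or.inl (by exact_mod_cast hn0.ne')) (Or.inl (by simp)), nu,
    lt_iSup_iff] at hn
  obtain ⟨c, hc⟩ := hn
  obtain ⟨hcm, hc⟩ := lt_iSup_iff.mp hc
  have hbc : n • b ≤ c := by
    rw [nsmul_eq_mul, mul_comm]
    have h1 : ((b * n : ℚ≥0) : ℝ≥0) < c := by
      push_cast
      exact_mod_cast hc
    exact (NNRat.cast_lt.mp h1).le
  obtain ⟨V', hξV', g, hg, hgf⟩ := stalk_anti 𝒥 hbc ξ hcm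
  rw [← map_pow] at hgf
  obtain ⟨V₁, hξ₁, i₁, i₂, heq⟩ := W.presheaf.germ_eq ξ hξV' (hV hξ) g (f ^ n) hgf
  obtain ⟨V₂, hξ₂, hle⟩ := exists_affine_le (U := V₁ ⊓ V.1) ⟨hξ₁, hξ⟩
  have h1 : V₂.1 ≤ V₁ := hle.trans inf_le_left
  have h2 : V₂.1 ≤ V.1 := hle.trans inf_le_right
  have hfn : resHom (h2.trans hV) f ^ n ∈ (𝒥.J (n • b)).ideal V₂ := by
    have h3 : resHom (h2.trans hV) (f ^ n) = resHom (h1.trans i₁.le) g := by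
      have := congrArg (res h1) heq
      exact (res_res i₂.le h1 (f ^ n)).symm.trans (this.symm.trans (res_res i₁.le h1 g))
    rw [← map_pow, h3]
    exact resHom_mem _ _ hg
  have hmem : resHom (h2.trans hV) f ∈ (intClSheaf 𝒥 b).ideal V₂ :=
    mem_intCl_of_pow_mem hn0 (le_intCl _ _ hfn)
  have hgerm : W.presheaf.germ V.1 ξ hξ (res hV f) =
      W.presheaf.germ V₂.1 ξ hξ₂ (resHom (h2.trans hV) f) := by
    rw [germ_resHom]
    exact germ_resHom hV ξ hξ f
  -- Finite generation, and with it the choice of `b`, is available on the covering set `U'` only,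
  -- so the stalk is computed from `U'`.
  rw [hgerm, map_germ_eq _ U' V ξ hξU' hξ]
  refine Ideal.map_mono (f := (W.presheaf.germ U'.1 ξ hξU').hom) hb ?_
  rw [← intClSheaf_ideal, ← map_germ_eq (intClSheaf 𝒥 b) U' V₂ ξ hξU' hξ₂]
  exact Ideal.mem_map_of_mem _ hmem

end Closure

theorem exists_smooth_algebra {k : Type u} [Field k] (π : W ⟶ Spec (CommRingCat.of k)) [Smooth π]
    (U : W.affineOpens) : ∃ _ : Algebra k Γ(W, U.1), Algebra.Smooth k Γ(W, U.1) := by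
  let S := Spec (CommRingCat.of k)
  have h₁ : (π.appLE ⊤ U.1 le_top).hom.Smooth :=
    Smooth.smooth_appLE π (isAffineOpen_top S) U.2 le_top
  have h₂ : ((Scheme.ΓSpecIso (CommRingCat.of k)).inv.hom).Smooth :=
    RingHom.Smooth.of_bijective
      (ConcreteCategory.bijective_of_isIso (Scheme.ΓSpecIso (CommRingCat.of k)).inv)
  have h₃ := h₂.comp h₁
  exact ⟨RingHom.toAlgebra (R := k) _, h₃⟩

end QRees

theorem mainTheorem6 {k : Type u} [Field k] (W : Scheme.{u}) (π : W ⟶ Spec (CommRingCat.of k))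
    [Smooth π] (𝒥 : QRees.QReesAlgebra W) :
    (∃ 𝒩 : QRees.QReesAlgebra W, 𝒩.family = QRees.radicalSaturation 𝒥) ∧
    (∃ 𝒩 : QRees.QReesAlgebra W, 𝒩.family = QRees.integralClosure 𝒥) ∧
    QRees.integralClosure 𝒥 = QRees.radicalSaturation 𝒥 := by
  let 𝒩 : QRees.QReesAlgebra W := QRees.intClAlgebra 𝒥 fun U hU => by
    obtain ⟨_, _⟩ := QRees.exists_smooth_algebra π U
    exact ReesClosure.isQReesRing_intCl k hU
  have hint : 𝒩.family = QRees.integralClosure 𝒥 :=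
    QRees.generated_eq 𝒩.isFiltration (QRees.isIntegralElem_subset 𝒥)
      (QRees.isIntegralElem_of_mem 𝒥)
  have hrad : 𝒩.family = QRees.radicalSaturation 𝒥 :=
    QRees.generated_eq 𝒩.isFiltration (QRees.isRadicalElem_subset 𝒥 fun U hU a ha => by
      obtain ⟨_, _⟩ := QRees.exists_smooth_algebra π U
      exact ReesClosure.exists_lt_intCl_le k hU ha) (QRees.isRadicalElem_of_mem 𝒥)
  exact ⟨⟨𝒩, hrad⟩, ⟨𝒩, hint⟩, hint.symm.trans hrad⟩
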